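/- Let $\mathcal V_D$ (datatype variables $\alpha,\beta,\dots$) and $\mathcal V_A$ (type variables $X,Y,\dots$) be disjoint countably infinite sets, and let $\mathcal C$ be a set of type constants $c,d,\dots$. Write $V,W$ for variables of either kind and $a$ for an element of $\mathcal V_D\cup\mathcal V_A\cup\mathcal C$. The $\mu$-datatypes $D$ and $\mu$-types $A$ are given, up to renaming of bound variables, by $$D ::= \alpha \mid c \mid D \mathbin{@} A \mid D\oplus D \mid \mu\alpha.D, \qquad A ::= X \mid D \mid A\supset A \mid A\oplus A \mid \mu X.A .$$ A $\mu$-type is contractive if in each of its subexpressions $\mu V.A$ the variable $V$ occurs in $A$ only under $\supset$ or $@$, if at all. Let $\mathcal T$ be the set of contractive $\mu$-types; all expressions below are assumed to be in $\mathcal T$. In every $\mu V.A$, and in rule (contr) below, a datatype variable $V=\alpha$ is only combined with datatypes, and $A\{B/V\}$ is capture-avoiding substitution. *Type equivalence* $\simeq_\mu$ is the relation on $\mathcal T$ defined inductively by the rules: - $A\simeq_\mu A$; if $A\simeq_\mu B$ and $B\simeq_\mu C$ then $A\simeq_\mu C$; if $A\simeq_\mu B$ then $B\simeq_\mu A$;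 - if $D\simeq_\mu D'$ (datatypes) and $A\simeq_\mu A'$ then $D\mathbin{@}A\simeq_\mu D'\mathbin{@}A'$; if $A\simeq_\mu A'$ and $B\simeq_\mu B'$ then $A\supset B\simeq_\mu A'\supset B'$ and $A\oplus B\simeq_\mu A'\oplus B'$; - $A\oplus A\simeq_\mu A$; $A\oplus B\simeq_\mu B\oplus A$; $A\oplus(B\oplus C)\simeq_\mu (A\oplus B)\oplus C$; - (rec) if $A\simeq_\mu B$ then $\mu V.A\simeq_\mu\mu V.B$; (fold) $\mu V.A\simeq_\mu A\{\mu V.A/V\}$; (contr) if $A\simeq_\mu B\{A/V\}$ and $\mu V.B$ is contractive then $A\simeq_\mu \mu V.B$. Write $\bigoplus_{i\in 1..n}A_i$ for a union of $A_1,\dots,A_n$ in this order, associated in any way, where no $A_i$ has root $\oplus$. Let $\mathscr C,\mathscr D$ range over contexts $A_1\oplus\dots\oplus A_{i-1}\oplus\Box\oplus A_{i+1}\oplus\dots\oplus A_n$ (associated in any way, $n\ge 1$) in which no $A_j$ has root $\oplus$ and none of $A_1,\dots,A_{i-1}$ has root $\mu$. *Coinductive type equality* $\simeq_{\vec\mu}$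 is the relation on $\mathcal T$ defined as the greatest fixed point of the generating function of the rules: - (e-refl-al) $a\simeq_{\vec\mu}a$; - (e-comp-al) if $D\simeq_{\vec\mu}D'$ and $A\simeq_{\vec\mu}A'$ then $D\mathbin{@}A\simeq_{\vec\mu}D'\mathbin{@}A'$; - (e-func-al) if $A\simeq_{\vec\mu}A'$ and $B\simeq_{\vec\mu}B'$ then $A\supset B\simeq_{\vec\mu}A'\supset B'$; - (e-rec-l-al) if $\mathscr C[A\{\mu V.A/V\}]\simeq_{\vec\mu}B$ then $\mathscr C[\mu V.A]\simeq_{\vec\mu}B$; - (e-rec-r-al) if $A\simeq_{\vec\mu}\mathscr D[B\{\mu W.B/W\}]$ and $A$ is not of the form $\mathscr C[\mu V.C]$ then $A\simeq_{\vec\mu}\mathscr D[\mu W.B]$; - (e-union-al) if no $A_i$ and no $B_j$ has root $\mu$ or $\oplus$, $n+m>2$, and there are functions $f:1..n\to 1..m$ and $g:1..m\to 1..n$ with $A_i\simeq_{\vec\mu}B_{f(i)}$ for all $i$ and $A_{g(j)}\simeq_{\vec\mu}B_j$ for all $j$, then $\bigoplus_{i\in 1..n}A_i\simeq_{\vec\mu}\bigoplus_{j\in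 1..m}B_j$. **Proposition.** For all $A,B\in\mathcal T$: $A\simeq_{\vec\mu}B$ if and only if $A\simeq_\mu B$. -/

import Mathlib

namespace MuTypes

universe u

/-- The two sorts of expressions: datatypes and (arbitrary) types. -/
inductive Kind : Type
  | data
  | type
  deriving DecidableEq

/-- Raw `μ`-type expressions up to renaming of bound variables, in de Bruijn representation, over a
set `C` of type constants. There are two independent countably infinite families of variables:
`var .data n` are the datatype variables and `var .type n` the type variables. The binder `mu k`
binds the variable `0` of kind `k` in its body, and leaves the variables of the other kind alone;
indices pointing outside of the expression are its free variables. -/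
inductive Pre (C : Type u) : Type u
  /-- A datatype variable `α` or a type variable `X`. -/
  | var (k : Kind) (n : ℕ)
  /-- A type constant `c`. -/
  | const (c : C)
  /-- The compound `D @ A`. -/
  | comp (D A : Pre C)
  /-- The type abstraction `A ⊃ B`. -/
  | func (A B : Pre C)
  /-- The union `A ⊕ B`. -/
  | union (A B : Pre C)
  /-- The recursive expression `μ V. A`, with `V` a variable of kind `k`. -/
  | mu (k : Kind) (A : Pre C)

namespace Pre

variable {C : Type u}

/-! ### Capture-avoiding substitution -/

/-- A renaming `ρ`, pushed under a binder of kind `k`. -/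
def liftRen (k : Kind) (ρ : Kind → ℕ → ℕ) : Kind → ℕ → ℕ := fun l n =>
  if l = k then
    match n with
    | 0 => 0
    | n + 1 => ρ l n + 1
  else ρ l n

/-- Apply a renaming to the free variables. -/
def rename (ρ : Kind → ℕ → ℕ) : Pre C → Pre C
  | var k n => var k (ρ k n)
  | const c => const c
  | comp D A => comp (rename ρ D) (rename ρ A)
  | func A B => func (rename ρ A) (rename ρ B)
  | union A B => union (rename ρ A) (rename ρ B)
  | mu k A => mu k (rename (liftRen k ρ) A)

/-- Weakening: make room for a fresh variable `0` of kind `k`. -/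
def shift (k : Kind) : Pre C → Pre C :=
  rename fun l n => if l = k then n + 1 else n

/-- A substitution `σ`, pushed under a binder of kind `k`. -/
def liftSub (k : Kind) (σ : Kind → ℕ → Pre C) : Kind → ℕ → Pre C := fun l n =>
  if l = k then
    match n with
    | 0 => var l 0
    | n + 1 => shift k (σ l n)
  else shift k (σ l n)

/-- Simultaneous capture-avoiding substitution. -/
def subst (σ : Kind → ℕ → Pre C) : Pre C → Pre C
  | var k n => σ k n
  | const c => const c
  | comp D A => comp (subst σ D) (subst σ A)
  | func A B => func (subst σ A) (subst σ B)
  | union A B => union (subst σ A) (subst σ B)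
  | mu k A => mu k (subst (liftSub k σ) A)

/-- `inst k S A` is `A{S/V}`, where `V` is the variable bound by the `μ` of kind `k` of which `A`
is the body. -/
def inst (k : Kind) (S A : Pre C) : Pre C :=
  subst (fun l n =>
    if l = k then
      match n with
      | 0 => S
      | n + 1 => var l n
    else var l n) A

/-- The unfolding `A{(μ V. A)/V}` of `μ V. A`. -/
def unfold (k : Kind) (A : Pre C) : Pre C := inst k (mu k A) A

/-! ### Sorting and contractiveness -/

/-- The grammar of `μ`-datatypes (`Sorted .data`) and of `μ`-types (`Sorted .type`):
`D ::= α | c | D @ A | D ⊕ D | μ α. D` and `A ::= X | D | A ⊃ A | A ⊕ A | μ X. A`. -/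
inductive Sorted : Kind → Pre C → Prop
  | var (k : Kind) (n : ℕ) : Sorted k (var k n)
  | const (c : C) : Sorted .data (const c)
  | comp {D A : Pre C} : Sorted .data D → Sorted .type A → Sorted .data (comp D A)
  | func {A B : Pre C} : Sorted .type A → Sorted .type B → Sorted .type (func A B)
  | union {k : Kind} {A B : Pre C} : Sorted k A → Sorted k B → Sorted k (union A B)
  | mu {k : Kind} {A : Pre C} : Sorted k A → Sorted k (mu k A)
  | ofData {D : Pre C} : Sorted .data D → Sorted .type D

/-- The variable `n` of kind `k` occurs only under a type constructor `⊃` or `@`, if at all. -/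
def Guarded (k : Kind) : ℕ → Pre C → Prop
  | n, var l m => ¬ (l = k ∧ m = n)
  | _, const _ => True
  | _, comp _ _ => True
  | _, func _ _ => True
  | n, union A B => Guarded k n A ∧ Guarded k n B
  | n, mu l A => Guarded k (if l = k then n + 1 else n) A

/-- In every subexpression `μ V. A`, the variable `V` is guarded in `A`. -/
def Contractive : Pre C → Prop
  | var _ _ => True
  | const _ => True
  | comp D A => Contractive D ∧ Contractive A
  | func A B => Contractive A ∧ Contractive B
  | union A B => Contractive A ∧ Contractive B
  | mu k A => Guarded k 0 A ∧ Contractive A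

/-- The contractive `μ`-datatypes (for `k = .data`) and the contractive `μ`-types
(for `k = .type`). -/
def IsMu (k : Kind) (A : Pre C) : Prop := Sorted k A ∧ Contractive A

/-- The set of contractive `μ`-types. -/
abbrev IsType (A : Pre C) : Prop := IsMu .type A

/-- The set of contractive `μ`-datatypes. -/
abbrev IsDatatype (A : Pre C) : Prop := IsMu .data A

/-! ### Type equivalence -/

/-- Type equivalence of contractive `μ`-types: the inductively defined relation. Its side conditions
only say that all expressions involved are contractive `μ`-types of the required kind; each rule
about `μ` stands for two rules, one for `μ α. D` and one for `μ X. A`. -/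
inductive Equiv : Pre C → Pre C → Prop
  | refl {A : Pre C} : IsType A → Equiv A A
  | trans {A B D : Pre C} : Equiv A B → Equiv B D → Equiv A D
  | symm {A B : Pre C} : Equiv A B → Equiv B A
  | comp {D D' A A' : Pre C} : IsDatatype D → IsDatatype D' →
      Equiv D D' → Equiv A A' → Equiv (comp D A) (comp D' A')
  | func {A A' B B' : Pre C} : Equiv A A' → Equiv B B' → Equiv (func A B) (func A' B')
  | union_idem {A : Pre C} : IsType A → Equiv (union A A) A
  | union_comm {A B : Pre C} : IsType A → IsType B → Equiv (union A B) (union B A)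
  | union_assoc {A B D : Pre C} : IsType A → IsType B → IsType D →
      Equiv (union A (union B D)) (union (union A B) D)
  | union {A A' B B' : Pre C} : Equiv A A' → Equiv B B' → Equiv (union A B) (union A' B')
  | recursion {k : Kind} {A B : Pre C} : IsMu k (mu k A) → IsMu k (mu k B) →
      Equiv A B → Equiv (mu k A) (mu k B)
  | fold {k : Kind} {A : Pre C} : IsMu k (mu k A) → Equiv (mu k A) (unfold k A)
  | contr {k : Kind} {A B : Pre C} : IsMu k A → IsMu k (mu k B) →
      Equiv A (inst k A B) → Equiv A (mu k B)

/-! ### Maximal unions -/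

/-- The list `[A₁, …, Aₙ]` of the non-union expressions for which the given expression is
`A₁ ⊕ ⋯ ⊕ Aₙ`, irrespective of how the unions are associated. -/
def summands : Pre C → List (Pre C)
  | union A B => summands A ++ summands B
  | A => [A]

/-- The root symbol is `μ`. -/
def IsRec (A : Pre C) : Prop := ∃ (k : Kind) (B : Pre C), A = mu k B

/-- Contexts built from one hole and unions, however associated. -/
inductive UCtx (C : Type u) : Type u
  | hole
  | left (K : UCtx C) (A : Pre C)
  | right (A : Pre C) (K : UCtx C)

/-- Fill the hole of a context. -/
def UCtx.fill (S : Pre C) : UCtx C → Pre C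
  | .hole => S
  | .left K A => union (K.fill S) A
  | .right A K => union A (K.fill S)

/-- No summand to the left of the hole is a `μ`: the context is
`A₁ ⊕ ⋯ ⊕ Aᵢ₋₁ ⊕ □ ⊕ Aᵢ₊₁ ⊕ ⋯ ⊕ Aₙ` with no `Aⱼ` a union and none of `A₁, …, Aᵢ₋₁` a `μ`. -/
def UCtx.Leftmost : UCtx C → Prop
  | .hole => True
  | .left K _ => K.Leftmost
  | .right A K => (∀ S ∈ summands A, ¬ IsRec S) ∧ K.Leftmost

/-! ### Coinductive type equality -/

/-- `Rule R A B`: the pair `A, B` is the conclusion of an instance of one of the rules of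
coinductive type equality whose premises are in `R`. -/
inductive Rule (R : Pre C → Pre C → Prop) : Pre C → Pre C → Prop
  | refl_var (k : Kind) (n : ℕ) : Rule R (var k n) (var k n)
  | refl_const (c : C) : Rule R (const c) (const c)
  | comp {D D' A A' : Pre C} : R D D' → R A A' → Rule R (comp D A) (comp D' A')
  | func {A A' B B' : Pre C} : R A A' → R B B' → Rule R (func A B) (func A' B')
  | rec_l {K : UCtx C} {k : Kind} {A B : Pre C} : K.Leftmost →
      R (K.fill (unfold k A)) B → Rule R (K.fill (mu k A)) B
  | rec_r {K : UCtx C} {k : Kind} {A B : Pre C} : K.Leftmost →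
      (∀ (K' : UCtx C) (l : Kind) (D : Pre C), K'.Leftmost → A ≠ K'.fill (mu l D)) →
      R A (K.fill (unfold k B)) → Rule R A (K.fill (mu k B))
  | union {A B : Pre C}
      (f : Fin (summands A).length → Fin (summands B).length)
      (g : Fin (summands B).length → Fin (summands A).length) :
      (∀ S ∈ summands A, ¬ IsRec S) → (∀ S ∈ summands B, ¬ IsRec S) →
      2 < (summands A).length + (summands B).length →
      (∀ i, R ((summands A).get i) ((summands B).get (f i))) →
      (∀ j, R ((summands A).get (g j)) ((summands B).get j)) →
      Rule R A B

theorem Rule.mono {R S : Pre C → Pre C → Prop} (h : R ≤ S) {A B : Pre C} (hr : Rule R A B) :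
    Rule S A B := by
  cases hr with
  | refl_var k n => exact .refl_var k n
  | refl_const c => exact .refl_const c
  | comp h1 h2 => exact .comp (h _ _ h1) (h _ _ h2)
  | func h1 h2 => exact .func (h _ _ h1) (h _ _ h2)
  | rec_l hK h1 => exact .rec_l hK (h _ _ h1)
  | rec_r hK hA h1 => exact .rec_r hK hA (h _ _ h1)
  | union f g h1 h2 h3 h4 h5 =>
    exact .union f g h1 h2 h3 (fun i => h _ _ (h4 i)) (fun j => h _ _ (h5 j))

/-- The generating function of the rules, on relations between contractive `μ`-types. -/
def genFun : (Pre C → Pre C → Prop) →o (Pre C → Pre C → Prop) where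
  toFun R := fun A B => IsType A ∧ IsType B ∧ Rule R A B
  monotone' := fun _ _ h _ _ hr => ⟨hr.1, hr.2.1, hr.2.2.mono h⟩

/-- Coinductive type equality: the greatest fixed point of the generating function. -/
def CoEq : Pre C → Pre C → Prop := OrderHom.gfp genFun

end Pre

end MuTypes

namespace MuTypes

namespace Pre

variable {C : Type*}

/-! ### Algebra of substitutions -/

/-! Both relations say that two types have the same infinite unfolding, modulo associativity,
commutativity and idempotence of `⊕`. Unfolding every `μ` outside the constructors `@` and `⊃`
exposes a finite set of `heads`; two types should be equal exactly when their heads match as sets,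
with equal arguments below them (`HeadMatch`). `Approx n` iterates this condition `n` times.

From type equivalence to coinductive equality: every rule preserves agreement to each depth
(`Equiv.approx`). For (rec) and (contr) this is an induction on the depth: a guarded variable lies
below a constructor, so agreement of its values to depth `n` gives agreement of the instances to
depth `n + 1`. Since head sets are finite, agreement to all depths entails head matching with
arguments agreeing to all depths, so it is a post-fixed point of the generating function
(`coEq_of_forall_approx`).

Conversely, coinductive equality entails head matching (`CoEq.headMatch`), as only finitely many
unfoldings can occur before a structural rule. Equal types `A`, `B` are then shown equivalent to one
common type (`exists_common_template`). The search runs through pairs from a finite set closed under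
subexpressions and unfolding (`closure`). Each new pair gets a variable, with `σ` and `τ` recording
its two sides; a pair met again is represented by its variable. Each type is the join of its heads,
so the templates of the matched head pairs unite to a guarded `G` of which both sides are instances,
and (contr) replaces them by instances of `μ V. G`. Initially `σ` and `τ` are the identity, so both
instances are the template itself. -/

/-- Extend a substitution by a value for the variable `0` of kind `k`. -/
def consSub (k : Kind) (S : Pre C) (σ : Kind → ℕ → Pre C) : Kind → ℕ → Pre C := fun l n =>
  if l = k then
    match n with
    | 0 => S
    | n + 1 => σ l n
  else σ l n

/-- The renaming underlying `shift`. -/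
def shiftRen (k : Kind) : Kind → ℕ → ℕ := fun l n => if l = k then n + 1 else n

/-- Under a binder of kind `k` a variable is either the bound one or a shifted outer one; this
avoids separate case splits on kind and index. -/
theorem kind_index_cases (k : Kind) {P : Kind → ℕ → Prop} (zero : P k 0)
    (succ : ∀ l n, P l (shiftRen k l n)) (l : Kind) (n : ℕ) : P l n := by
  by_cases h : l = k
  · subst h
    cases n with
    | zero => exact zero
    | succ n => simpa [shiftRen] using succ l n
  · simpa [shiftRen, h] using succ l n

@[simp] theorem consSub_zero (k : Kind) (S : Pre C) (σ : Kind → ℕ → Pre C) :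
    consSub k S σ k 0 = S := by simp [consSub]

@[simp] theorem consSub_shiftRen (k : Kind) (S : Pre C) (σ : Kind → ℕ → Pre C) (l : Kind) (n : ℕ) :
    consSub k S σ l (shiftRen k l n) = σ l n := by
  by_cases h : l = k <;> simp [consSub, shiftRen, h]

@[simp] theorem liftSub_zero (k : Kind) (σ : Kind → ℕ → Pre C) : liftSub k σ k 0 = var k 0 := by
  simp [liftSub]

@[simp] theorem liftSub_shiftRen (k : Kind) (σ : Kind → ℕ → Pre C) (l : Kind) (n : ℕ) :
    liftSub k σ l (shiftRen k l n) = shift k (σ l n) := by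
  by_cases h : l = k <;> simp [liftSub, shiftRen, h]

@[simp] theorem liftRen_zero (k : Kind) (ρ : Kind → ℕ → ℕ) : liftRen k ρ k 0 = 0 := by
  simp [liftRen]

@[simp] theorem liftRen_shiftRen (k : Kind) (ρ : Kind → ℕ → ℕ) (l : Kind) (n : ℕ) :
    liftRen k ρ l (shiftRen k l n) = shiftRen k l (ρ l n) := by
  by_cases h : l = k <;> simp [liftRen, shiftRen, h]

theorem shift_eq (k : Kind) (A : Pre C) : shift k A = rename (shiftRen k) A := rfl

@[simp] theorem shift_var (k l : Kind) (n : ℕ) :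
    shift k (var l n : Pre C) = var l (shiftRen k l n) := rfl

theorem shiftRen_ne_zero (k : Kind) (n : ℕ) : shiftRen k k n ≠ 0 := by simp [shiftRen]

theorem var_shiftRen_ne (k l : Kind) (n : ℕ) : (var l (shiftRen k l n) : Pre C) ≠ var k 0 := by
  intro h
  injection h with h1 h2
  subst h1
  exact shiftRen_ne_zero _ _ h2

theorem inst_eq (k : Kind) (S A : Pre C) : inst k S A = subst (consSub k S var) A := by
  unfold inst
  congr 1

theorem funext_kind_index (k : Kind) {α : Type*} {f g : Kind → ℕ → α} (zero : f k 0 = g k 0)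
    (succ : ∀ l n, f l (shiftRen k l n) = g l (shiftRen k l n)) : f = g := by
  funext l n
  exact kind_index_cases k (P := fun l n => f l n = g l n) zero succ l n

theorem rename_rename (A : Pre C) : ∀ (ρ ρ' : Kind → ℕ → ℕ),
    rename ρ' (rename ρ A) = rename (fun l n => ρ' l (ρ l n)) A := by
  induction A with
  | mu k A ih =>
    intro ρ ρ'
    simp only [rename, ih]
    congr 2
    apply funext_kind_index k <;> simp
  | _ => simp_all [rename]

theorem subst_rename (A : Pre C) : ∀ (ρ : Kind → ℕ → ℕ) (σ : Kind → ℕ → Pre C),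
    subst σ (rename ρ A) = subst (fun l n => σ l (ρ l n)) A := by
  induction A with
  | mu k A ih =>
    intro ρ σ
    simp only [rename, subst, ih]
    congr 2
    apply funext_kind_index k <;> simp
  | _ => simp_all [rename, subst]

theorem rename_subst (A : Pre C) : ∀ (ρ : Kind → ℕ → ℕ) (σ : Kind → ℕ → Pre C),
    rename ρ (subst σ A) = subst (fun l n => rename ρ (σ l n)) A := by
  induction A with
  | mu k A ih =>
    intro ρ σ
    simp only [rename, subst, ih]
    congr 2
    apply funext_kind_index k <;> simp [rename, shift_eq, rename_rename]
  | _ => simp_all [rename, subst]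

theorem subst_subst (A : Pre C) : ∀ (σ τ : Kind → ℕ → Pre C),
    subst τ (subst σ A) = subst (fun l n => subst τ (σ l n)) A := by
  induction A with
  | mu k A ih =>
    intro σ τ
    simp only [subst, ih]
    congr 2
    apply funext_kind_index k <;> simp [subst, shift_eq, rename_subst, subst_rename]
  | _ => simp_all [subst]

theorem subst_var (A : Pre C) : subst var A = A := by
  induction A with
  | mu k A ih =>
    have : liftSub k (var : Kind → ℕ → Pre C) = var := by
      apply funext_kind_index k <;> simp
    simp [subst, this, ih]
  | _ => simp_all [subst]

@[simp] theorem inst_shift (k : Kind) (S A : Pre C) : inst k S (shift k A) = A := by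
  rw [inst_eq, shift_eq, subst_rename]
  simp [subst_var]

/-- Instantiating the body of a substituted `μ` amounts to one extended substitution; this is how
(contr) applies to instances of a template. -/
theorem inst_subst_liftSub (k : Kind) (S A : Pre C) (σ : Kind → ℕ → Pre C) :
    inst k S (subst (liftSub k σ) A) = subst (consSub k S σ) A := by
  rw [inst_eq, subst_subst]
  congr 1
  apply funext_kind_index k
  · simp [subst]
  · intro l n
    rw [liftSub_shiftRen, ← inst_eq, inst_shift, consSub_shiftRen]

theorem subst_inst (k : Kind) (S A : Pre C) (σ : Kind → ℕ → Pre C) :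
    subst σ (inst k S A) = inst k (subst σ S) (subst (liftSub k σ) A) := by
  rw [inst_subst_liftSub, inst_eq, subst_subst]
  congr 1
  apply funext_kind_index k <;> simp [subst]

theorem subst_unfold (k : Kind) (A : Pre C) (σ : Kind → ℕ → Pre C) :
    subst σ (unfold k A) = unfold k (subst (liftSub k σ) A) := subst_inst k _ A σ

theorem rename_inst (k : Kind) (S A : Pre C) (ρ : Kind → ℕ → ℕ) :
    rename ρ (inst k S A) = inst k (rename ρ S) (rename (liftRen k ρ) A) := by
  rw [inst_eq, inst_eq, rename_subst, subst_rename]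
  congr 1
  apply funext_kind_index k <;> simp [rename]

/-! ### Heads -/

/-- The expressions that are neither a union nor a `μ` which become summands of the given
expression once every `μ` among its summands has been unfolded. -/
def heads : Pre C → Set (Pre C)
  | union A B => heads A ∪ heads B
  -- An unguarded bound variable would unfold to the `μ` itself and add no head. Discarding it lets
  -- the recursion be structural, with no contractiveness assumed.
  | mu k A => inst k (mu k A) '' (heads A \ {var k 0})
  | A => {A}

@[simp] theorem heads_var (k : Kind) (n : ℕ) : heads (var k n : Pre C) = {var k n} := rfl
@[simp] theorem heads_const (c : C) : heads (const c) = {const c} := rfl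
@[simp] theorem heads_comp (D A : Pre C) : heads (comp D A) = {comp D A} := rfl
@[simp] theorem heads_func (A B : Pre C) : heads (func A B) = {func A B} := rfl
@[simp] theorem heads_union (A B : Pre C) : heads (union A B) = heads A ∪ heads B := rfl
theorem heads_mu (k : Kind) (A : Pre C) :
    heads (mu k A) = inst k (mu k A) '' (heads A \ {var k 0}) := rfl

/-- The expression is neither a union nor a `μ`. -/
inductive IsAtom : Pre C → Prop
  | var (k : Kind) (n : ℕ) : IsAtom (var k n)
  | const (c : C) : IsAtom (const c)
  | comp (D A : Pre C) : IsAtom (comp D A)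
  | func (A B : Pre C) : IsAtom (func A B)

theorem IsAtom.heads_eq {A : Pre C} (h : IsAtom A) : heads A = {A} := by
  cases h <;> rfl

theorem isAtom_inst {k : Kind} {S A : Pre C} (h : IsAtom A) (hA : A ≠ var k 0) :
    IsAtom (inst k S A) := by
  rw [inst_eq]
  cases h with
  | var l n =>
    revert hA
    refine kind_index_cases k (P := fun l n => (var l n : Pre C) ≠ var k 0 →
      IsAtom (subst (consSub k S var) (var l n))) (fun h => (h rfl).elim) ?_ l n
    intro l n _
    simpa [subst] using IsAtom.var l n
  | const => exact .const _
  | comp => exact .comp _ _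
  | func => exact .func _ _

theorem isAtom_of_mem_heads {A S : Pre C} (h : S ∈ heads A) : IsAtom S := by
  induction A generalizing S with
  | var k n => rw [Set.mem_singleton_iff.1 h]; exact .var k n
  | const c => rw [Set.mem_singleton_iff.1 h]; exact .const c
  | comp D A => rw [Set.mem_singleton_iff.1 h]; exact .comp D A
  | func A B => rw [Set.mem_singleton_iff.1 h]; exact .func A B
  | union A B ihA ihB => exact h.elim ihA ihB
  | mu k A ih =>
    obtain ⟨T, ⟨hT, hne⟩, rfl⟩ := h
    exact isAtom_inst (ih hT) hne

theorem finite_heads (A : Pre C) : (heads A).Finite := by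
  induction A with
  | union A B ihA ihB => exact ihA.union ihB
  | mu k A ih => exact (ih.subset Set.sdiff_subset).image _
  | _ => exact Set.finite_singleton _

theorem rename_liftRen_eq_var_zero {k : Kind} {ρ : Kind → ℕ → ℕ} {A : Pre C} :
    rename (liftRen k ρ) A = var k 0 ↔ A = var k 0 := by
  constructor
  · intro h
    cases A with
    | var l n =>
      revert h
      refine kind_index_cases k (P := fun l n => rename (liftRen k ρ) (var l n : Pre C) = var k 0 →
        (var l n : Pre C) = var k 0) (fun _ => rfl) ?_ l n
      intro l n h
      rw [rename, liftRen_shiftRen] at h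
      exact (var_shiftRen_ne k l _ h).elim
    | _ => simp [rename] at h
  · rintro rfl
    simp [rename]

theorem heads_rename (A : Pre C) : ∀ ρ : Kind → ℕ → ℕ,
    heads (rename ρ A) = rename ρ '' heads A := by
  induction A with
  | union A B ihA ihB => intro ρ; simp [rename, ihA, ihB, Set.image_union]
  | mu k A ih =>
    intro ρ
    ext T
    simp only [rename, heads_mu, ih, Set.mem_image, Set.mem_sdiff, Set.mem_singleton_iff]
    constructor
    · rintro ⟨_, ⟨⟨S, hS, rfl⟩, hne⟩, rfl⟩
      exact ⟨_, ⟨S, ⟨hS, fun h => hne (rename_liftRen_eq_var_zero.2 h)⟩, rfl⟩,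
        rename_inst k _ _ ρ⟩
    · rintro ⟨_, ⟨S, ⟨hS, hne⟩, rfl⟩, rfl⟩
      exact ⟨_, ⟨⟨S, hS, rfl⟩, fun h => hne (rename_liftRen_eq_var_zero.1 h)⟩,
        (rename_inst k (mu k A) S ρ).symm⟩
  | _ => intro ρ; simp [rename]

theorem heads_shift (k : Kind) (A : Pre C) : heads (shift k A) = shift k '' heads A :=
  heads_rename A _

theorem shift_ne_var_zero (k : Kind) (A : Pre C) : shift k A ≠ var k 0 := by
  intro h
  cases A with
  | var l n => exact var_shiftRen_ne k l n h
  | _ => simp [shift, rename] at h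

/-- The contribution of a head of the body of a `μ` to the heads of a substitution instance. -/
theorem heads_subst_inst {k : Kind} {S M : Pre C} (hS : IsAtom S) (hne : S ≠ var k 0)
    (σ : Kind → ℕ → Pre C) :
    heads (inst k M (subst (liftSub k σ) S)) =
      inst k M '' (heads (subst (liftSub k σ) S) \ {var k 0}) := by
  cases hS with
  | var l n =>
    revert hne
    refine kind_index_cases k (P := fun l n => (var l n : Pre C) ≠ var k 0 →
      heads (inst k M (subst (liftSub k σ) (var l n))) =
        inst k M '' (heads (subst (liftSub k σ) (var l n)) \ {var k 0})) (fun h => (h rfl).elim) ?_ l n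
    intro l n _
    rw [subst, liftSub_shiftRen, inst_shift, heads_shift]
    ext T
    simp only [Set.mem_image, Set.mem_sdiff, Set.mem_singleton_iff]
    constructor
    · intro hT
      exact ⟨_, ⟨⟨T, hT, rfl⟩, shift_ne_var_zero k T⟩, inst_shift k _ _⟩
    · rintro ⟨_, ⟨⟨U, hU, rfl⟩, -⟩, rfl⟩
      simpa using hU
  | _ => ext T; simp [subst, inst_eq, eq_comm]

/-- A head built by a constructor stays a head under substitution; only variable heads are expanded.
Under a `μ` this is consistent because `liftSub` fixes the bound variable and keeps it out of all
other values. -/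
theorem mem_heads_subst (A : Pre C) : ∀ (σ : Kind → ℕ → Pre C) {T : Pre C},
    T ∈ heads (subst σ A) ↔ ∃ S ∈ heads A, T ∈ heads (subst σ S) := by
  induction A with
  | union A B ihA ihB =>
    intro σ T
    simp only [subst, heads_union, Set.mem_union, ihA, ihB, or_and_right, exists_or]
  | mu k A ih =>
    intro σ T
    have key : ∀ S ∈ heads A, S ≠ var k 0 → heads (subst σ (inst k (mu k A) S)) =
        inst k (mu k (subst (liftSub k σ) A)) '' (heads (subst (liftSub k σ) S) \ {var k 0}) := by
      intro S hS hne
      rw [subst_inst, subst, heads_subst_inst (isAtom_of_mem_heads hS) hne]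
    simp only [subst, heads_mu, Set.mem_image, Set.mem_sdiff, Set.mem_singleton_iff, ih]
    constructor
    · rintro ⟨U, ⟨⟨S, hS, hU⟩, hne⟩, rfl⟩
      have hS0 : S ≠ var k 0 := by
        rintro rfl
        exact hne (by simpa [subst] using hU)
      refine ⟨_, ⟨S, ⟨hS, hS0⟩, rfl⟩, ?_⟩
      rw [key S hS hS0]
      exact ⟨U, ⟨hU, hne⟩, rfl⟩
    · rintro ⟨_, ⟨S, ⟨hS, hS0⟩, rfl⟩, hT⟩
      rw [key S hS hS0] at hT
      obtain ⟨U, ⟨hU, hne⟩, rfl⟩ := hT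
      exact ⟨U, ⟨⟨S, hS, hU⟩, hne⟩, rfl⟩
  | _ => intro σ T; simp

/-- If the bound variable is itself a head of the body, its replacement only contributes the heads
of the `μ` again, so contractiveness is not needed. -/
theorem heads_unfold (k : Kind) (A : Pre C) : heads (unfold k A) = heads (mu k A) := by
  ext T
  have key : ∀ S ∈ heads A, S ≠ var k 0 →
      heads (inst k (mu k A) S) = {inst k (mu k A) S} := fun S hS hne =>
    (isAtom_inst (isAtom_of_mem_heads hS) hne).heads_eq
  rw [unfold, inst_eq, mem_heads_subst]
  simp only [← inst_eq]
  constructor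
  · rintro ⟨S, hS, hT⟩
    by_cases hne : S = var k 0
    · subst hne
      simpa [inst_eq, subst] using hT
    · rw [key S hS hne] at hT
      exact ⟨S, ⟨hS, hne⟩, hT.symm⟩
  · rintro ⟨S, ⟨hS, hne⟩, rfl⟩
    exact ⟨S, hS, by rw [key S hS hne]; rfl⟩

/-! ### Guardedness as absence from the heads -/

theorem inst_eq_var {k l : Kind} {n : ℕ} {M S : Pre C} (hS : S ≠ var k 0) :
    inst k M S = var l n ↔ S = var l (shiftRen k l n) := by
  constructor
  · intro h
    cases S with
    | var j m =>
      revert hS h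
      refine kind_index_cases k (P := fun j m => (var j m : Pre C) ≠ var k 0 →
        inst k M (var j m) = var l n → (var j m : Pre C) = var l (shiftRen k l n))
        (fun h => (h rfl).elim) ?_ j m
      intro j m _ h
      rw [inst_eq, subst, consSub_shiftRen] at h
      injection h with h1 h2
      rw [h1, h2]
    | _ => simp [inst_eq, subst] at h
  · rintro rfl
    simp [inst_eq, subst]

/-- Reduces stability of guardedness and contractiveness to the behaviour of heads under renaming
and substitution. -/
theorem guarded_iff (A : Pre C) : ∀ {k : Kind} {n : ℕ}, Guarded k n A ↔ var k n ∉ heads A := by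
  induction A with
  | var l m => intro k n; simp [Guarded, eq_comm]
  | union A B ihA ihB => intro k n; simp [Guarded, ihA, ihB]
  | mu l A ih =>
    intro k n
    have : (if l = k then n + 1 else n) = shiftRen l k n := by simp [shiftRen, eq_comm]
    rw [Guarded, this, ih, heads_mu, not_iff_not]
    constructor
    · intro h
      exact ⟨_, ⟨h, var_shiftRen_ne l k n⟩, (inst_eq_var (var_shiftRen_ne l k n)).2 rfl⟩
    · rintro ⟨S, ⟨hS, hne⟩, h⟩
      rwa [(inst_eq_var hne).1 h] at hS
  | _ => intro k n; simp [Guarded]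

theorem guarded_mu {l k : Kind} {n : ℕ} {A : Pre C} :
    Guarded k n (mu l A) ↔ Guarded k (shiftRen l k n) A := by
  simp [Guarded, shiftRen, eq_comm]

theorem guarded_subst {A : Pre C} {k : Kind} {n : ℕ} {σ : Kind → ℕ → Pre C}
    (h : ∀ l m, ¬ Guarded l m A → Guarded k n (σ l m)) : Guarded k n (subst σ A) := by
  rw [guarded_iff, mem_heads_subst]
  rintro ⟨S, hS, hv⟩
  have hat := isAtom_of_mem_heads hS
  cases hat with
  | var l m =>
    have := h l m (by rw [guarded_iff]; exact fun h => h hS)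
    exact guarded_iff _ |>.1 this hv
  | _ => simp [subst] at hv

theorem guarded_zero_shift (k : Kind) (A : Pre C) : Guarded k 0 (shift k A) := by
  rw [guarded_iff, heads_shift]
  rintro ⟨S, -, h⟩
  exact shift_ne_var_zero k S h

theorem guarded_zero_subst_liftSub {k : Kind} {A : Pre C} (h : Guarded k 0 A)
    (σ : Kind → ℕ → Pre C) : Guarded k 0 (subst (liftSub k σ) A) := by
  refine guarded_subst fun l m => ?_
  refine kind_index_cases k (P := fun l m => ¬ Guarded l m A → Guarded k 0 (liftSub k σ l m))
    (fun h' => (h' h).elim) ?_ l m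
  intro l m _
  rw [liftSub_shiftRen]
  exact guarded_zero_shift k _

/-! ### Closure of contractive expressions under substitution -/

theorem contractive_rename {A : Pre C} (h : Contractive A) : ∀ ρ : Kind → ℕ → ℕ,
    Contractive (rename ρ A) := by
  induction A with
  | mu k A ih =>
    intro ρ
    refine ⟨?_, ih h.2 _⟩
    rw [guarded_iff, heads_rename]
    rintro ⟨S, hS, hv⟩
    rw [rename_liftRen_eq_var_zero] at hv
    exact guarded_iff _ |>.1 h.1 (hv ▸ hS)
  | _ => intro ρ; simp_all [rename, Contractive]

theorem contractive_subst {A : Pre C} (h : Contractive A) : ∀ {σ : Kind → ℕ → Pre C},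
    (∀ l n, Contractive (σ l n)) → Contractive (subst σ A) := by
  induction A with
  | mu k A ih =>
    intro σ hσ
    refine ⟨guarded_zero_subst_liftSub h.1 σ, ih h.2 fun l n => ?_⟩
    refine kind_index_cases k (P := fun l n => Contractive (liftSub k σ l n)) ?_ ?_ l n
    · simp [Contractive]
    · intro l n
      rw [liftSub_shiftRen]
      exact contractive_rename (hσ l n) _
  | _ => intro σ hσ; simp_all [subst, Contractive]

theorem sorted_rename {j : Kind} {A : Pre C} (h : Sorted j A) : ∀ ρ : Kind → ℕ → ℕ,
    Sorted j (rename ρ A) := by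
  induction h with
  | var k n => exact fun ρ => .var k _
  | const c => exact fun ρ => .const c
  | comp _ _ ih ih' => exact fun ρ => .comp (ih ρ) (ih' ρ)
  | func _ _ ih ih' => exact fun ρ => .func (ih ρ) (ih' ρ)
  | union _ _ ih ih' => exact fun ρ => .union (ih ρ) (ih' ρ)
  | mu _ ih => exact fun ρ => .mu (ih _)
  | ofData _ ih => exact fun ρ => .ofData (ih ρ)

theorem sorted_subst {j : Kind} {A : Pre C} (h : Sorted j A) : ∀ {σ : Kind → ℕ → Pre C},
    (∀ l n, Sorted l (σ l n)) → Sorted j (subst σ A) := by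
  induction h with
  | var k n => exact fun hσ => hσ k n
  | const c => exact fun hσ => .const c
  | comp _ _ ih ih' => exact fun hσ => .comp (ih hσ) (ih' hσ)
  | func _ _ ih ih' => exact fun hσ => .func (ih hσ) (ih' hσ)
  | union _ _ ih ih' => exact fun hσ => .union (ih hσ) (ih' hσ)
  | @mu k A _ ih =>
    refine fun {σ} hσ => .mu (ih fun l n => ?_)
    refine kind_index_cases k (P := fun l n => Sorted l (liftSub k σ l n)) ?_ ?_ l n
    · rw [liftSub_zero]
      exact .var k 0
    · intro l n
      rw [liftSub_shiftRen]
      exact sorted_rename (hσ l n) _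
  | ofData _ ih => exact fun hσ => .ofData (ih hσ)

theorem IsMu.subst {j : Kind} {A : Pre C} (h : IsMu j A) {σ : Kind → ℕ → Pre C}
    (hσ : ∀ l n, IsMu l (σ l n)) : IsMu j (subst σ A) :=
  ⟨sorted_subst h.1 fun l n => (hσ l n).1, contractive_subst h.2 fun l n => (hσ l n).2⟩

theorem isMu_var (k : Kind) (n : ℕ) : IsMu k (var k n : Pre C) := ⟨.var k n, trivial⟩

theorem isMu_consSub {k : Kind} {S : Pre C} {σ : Kind → ℕ → Pre C} (hS : IsMu k S)
    (hσ : ∀ l n, IsMu l (σ l n)) (l : Kind) (n : ℕ) : IsMu l (consSub k S σ l n) :=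
  kind_index_cases k (P := fun l n => IsMu l (consSub k S σ l n)) (by simpa using hS)
    (by simpa using hσ) l n

theorem IsMu.inst {j k : Kind} {A S : Pre C} (hA : IsMu j A) (hS : IsMu k S) :
    IsMu j (inst k S A) := by
  rw [inst_eq]
  exact hA.subst (isMu_consSub hS isMu_var)

theorem IsMu.isType {k : Kind} {A : Pre C} (h : IsMu k A) : IsType A := by
  cases k with
  | data => exact ⟨.ofData h.1, h.2⟩
  | type => exact h

/-! ### Inversion of sorting -/

theorem sorted_comp {j : Kind} {D A : Pre C} (h : Sorted j (comp D A)) :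
    Sorted .data D ∧ Sorted .type A := by
  generalize hE : comp D A = E at h
  induction h <;> cases hE
  case comp => exact ⟨by assumption, by assumption⟩
  case ofData ih => exact ih rfl

theorem sorted_func {j : Kind} {A B : Pre C} (h : Sorted j (func A B)) :
    j = .type ∧ Sorted .type A ∧ Sorted .type B := by
  generalize hE : func A B = E at h
  induction h <;> cases hE
  case func => exact ⟨rfl, by assumption, by assumption⟩
  case ofData ih => exact ⟨rfl, (ih rfl).2⟩

theorem sorted_union {j : Kind} {A B : Pre C} (h : Sorted j (union A B)) :
    Sorted j A ∧ Sorted j B := by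
  generalize hE : union A B = E at h
  induction h <;> cases hE
  case union => exact ⟨by assumption, by assumption⟩
  case ofData ih => exact ⟨.ofData (ih rfl).1, .ofData (ih rfl).2⟩

theorem sorted_mu {j k : Kind} {A : Pre C} (h : Sorted j (mu k A)) :
    Sorted k (mu k A) ∧ Sorted k A ∧ (j = k ∨ k = .data ∧ j = .type) := by
  generalize hE : mu k A = E at h
  induction h <;> cases hE
  case mu h _ => exact ⟨.mu h, h, .inl rfl⟩
  case ofData ih =>
    obtain ⟨h1, h2, h3⟩ := ih rfl
    refine ⟨h1, h2, .inr ⟨?_, rfl⟩⟩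
    rcases h3 with h3 | h3
    · exact h3.symm
    · exact h3.1

theorem sorted_var_index {j k : Kind} {n : ℕ} (h : Sorted j (var k n : Pre C)) (m : ℕ) :
    Sorted j (var k m : Pre C) := by
  generalize hE : var k n = E at h
  induction h <;> cases hE
  case var => exact .var _ _
  case ofData ih => exact .ofData (ih rfl)

theorem IsMu.comp {j : Kind} {D A : Pre C} (h : IsMu j (comp D A)) : IsMu .data D ∧ IsMu .type A :=
  ⟨⟨(sorted_comp h.1).1, h.2.1⟩, (sorted_comp h.1).2, h.2.2⟩

theorem IsMu.func {j : Kind} {A B : Pre C} (h : IsMu j (func A B)) : IsMu .type A ∧ IsMu .type B :=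
  ⟨⟨(sorted_func h.1).2.1, h.2.1⟩, (sorted_func h.1).2.2, h.2.2⟩

theorem IsMu.union {j : Kind} {A B : Pre C} (h : IsMu j (union A B)) : IsMu j A ∧ IsMu j B :=
  ⟨⟨(sorted_union h.1).1, h.2.1⟩, (sorted_union h.1).2, h.2.2⟩

theorem IsMu.mu_self {j k : Kind} {A : Pre C} (h : IsMu j (mu k A)) : IsMu k (mu k A) :=
  ⟨(sorted_mu h.1).1, h.2⟩

theorem IsMu.body {j k : Kind} {A : Pre C} (h : IsMu j (mu k A)) : IsMu k A :=
  ⟨(sorted_mu h.1).2.1, h.2.2⟩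

theorem IsMu.of_mu {j k : Kind} {A B : Pre C} (h : IsMu j (mu k A)) (hB : IsMu k B) :
    IsMu j B := by
  rcases (sorted_mu h.1).2.2 with rfl | ⟨rfl, rfl⟩
  · exact hB
  · exact hB.isType

theorem IsMu.unfold {j k : Kind} {A : Pre C} (h : IsMu j (mu k A)) : IsMu j (unfold k A) :=
  h.of_mu (h.body.inst h.mu_self)

theorem isType_union {A B : Pre C} : IsType (union A B) ↔ IsType A ∧ IsType B :=
  ⟨IsMu.union, fun h => ⟨.union h.1.1 h.2.1, h.1.2, h.2.2⟩⟩

theorem IsMu.of_mem_heads {A : Pre C} : ∀ {j : Kind} {S : Pre C}, IsMu j A → S ∈ heads A →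
    IsMu j S := by
  induction A with
  | union A B ihA ihB =>
    intro j S h hS
    exact hS.elim (ihA h.union.1) (ihB h.union.2)
  | mu k A ih =>
    rintro j _ h ⟨S, ⟨hS, -⟩, rfl⟩
    exact h.of_mu ((ih h.body hS).inst h.mu_self)
  | _ =>
    intro j S h hS
    rwa [Set.mem_singleton_iff.1 hS]

/-! ### Induction along unfolding -/

/-- The number of unions and binders that are not below a type constructor. -/
def height : Pre C → ℕ
  | union A B => height A + height B + 1
  | mu _ A => height A + 1
  | _ => 0

theorem height_rename (A : Pre C) : ∀ ρ : Kind → ℕ → ℕ, height (rename ρ A) = height A := by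
  induction A with
  | mu k A ih => intro ρ; simp [rename, height, ih]
  | _ => intro ρ; simp_all [rename, height]

theorem height_subst (A : Pre C) : ∀ {σ : Kind → ℕ → Pre C},
    (∀ l n, ¬ Guarded l n A → height (σ l n) = 0) → height (subst σ A) = height A := by
  induction A with
  | var k n => intro σ h; exact h k n (by simp [Guarded])
  | union A B ihA ihB =>
    intro σ h
    simp only [subst, height]
    rw [ihA fun l n hg => h l n fun hg' => hg hg'.1, ihB fun l n hg => h l n fun hg' => hg hg'.2]
  | mu k A ih =>
    intro σ h
    simp only [subst, height]
    rw [ih]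
    intro l n
    refine kind_index_cases k (P := fun l n => ¬ Guarded l n A → height (liftSub k σ l n) = 0)
      (fun _ => by simp [height]) ?_ l n
    intro l n hg
    rw [liftSub_shiftRen, shift_eq, height_rename]
    exact h l n (by rwa [guarded_mu])
  | _ => intro σ _; simp [subst, height]

/-- The copies of the `μ` land below constructors, where `height` does not look. Hence unfolding a
contractive `μ` strictly lowers the height. -/
theorem height_unfold {k : Kind} {A : Pre C} (h : Guarded k 0 A) :
    height (unfold k A) = height A := by
  rw [unfold, inst_eq]
  refine height_subst A fun l n => ?_
  refine kind_index_cases k (P := fun l n => ¬ Guarded l n A →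
    height (consSub k (mu k A) var l n) = 0) (fun h' => (h' h).elim) ?_ l n
  intro l n _
  simp [height]

/-- Induction on `height`, since an unfolding is not a subexpression. The kind `j` stays fixed
because summands and unfoldings inherit it. -/
theorem unfold_induction {P : Pre C → Prop} (atom : ∀ A, IsAtom A → P A)
    (union' : ∀ A B, P A → P B → P (union A B)) {j : Kind}
    (mu' : ∀ k A, IsMu j (mu k A) → P (unfold k A) → P (mu k A)) {A : Pre C} (hA : IsMu j A) :
    P A := by
  induction hn : height A using Nat.strong_induction_on generalizing A with
  | _ n ih =>
    subst hn
    cases A with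
    | var k n => exact atom _ (.var k n)
    | const c => exact atom _ (.const c)
    | comp D A => exact atom _ (.comp D A)
    | func A B => exact atom _ (.func A B)
    | union A B =>
      exact union' A B (ih _ (by simp only [height]; omega) hA.union.1 rfl)
        (ih _ (by simp only [height]; omega) hA.union.2 rfl)
    | mu k A =>
      refine mu' k A hA (ih _ ?_ hA.unfold rfl)
      rw [height_unfold hA.2.1]
      simp [height]

/-! ### Matching of heads -/

/-- The two expressions have the same root, which is neither a union nor a `μ`, and related
arguments. -/
inductive AtomRel (R : Pre C → Pre C → Prop) : Pre C → Pre C → Prop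
  | var (k : Kind) (n : ℕ) : AtomRel R (var k n) (var k n)
  | const (c : C) : AtomRel R (const c) (const c)
  | comp {D D' A A' : Pre C} : R D D' → R A A' → AtomRel R (comp D A) (comp D' A')
  | func {A A' B B' : Pre C} : R A A' → R B B' → AtomRel R (func A B) (func A' B')

/-- Every head on either side is matched by a head on the other side. -/
def HeadMatch (R : Pre C → Pre C → Prop) (A B : Pre C) : Prop :=
  (∀ S ∈ heads A, ∃ T ∈ heads B, AtomRel R S T) ∧ ∀ T ∈ heads B, ∃ S ∈ heads A, AtomRel R S T

theorem AtomRel.imp {R R' : Pre C → Pre C → Prop} {A B : Pre C} (h : AtomRel R A B)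
    (hR : ∀ A B, R A B → R' A B) : AtomRel R' A B := by
  cases h with
  | var k n => exact .var k n
  | const c => exact .const c
  | comp h1 h2 => exact .comp (hR _ _ h1) (hR _ _ h2)
  | func h1 h2 => exact .func (hR _ _ h1) (hR _ _ h2)

theorem AtomRel.swap {R : Pre C → Pre C → Prop} (hR : ∀ A B, R A B → R B A) {A B : Pre C}
    (h : AtomRel R A B) : AtomRel R B A := by
  cases h with
  | var k n => exact .var k n
  | const c => exact .const c
  | comp h1 h2 => exact .comp (hR _ _ h1) (hR _ _ h2)
  | func h1 h2 => exact .func (hR _ _ h1) (hR _ _ h2)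

theorem AtomRel.trans {R : Pre C → Pre C → Prop} (hR : ∀ A B D, R A B → R B D → R A D)
    {A B D : Pre C} (h : AtomRel R A B) (h' : AtomRel R B D) : AtomRel R A D := by
  cases h with
  | var k n => exact h'
  | const c => exact h'
  | comp h1 h2 => cases h' with | comp h3 h4 => exact .comp (hR _ _ _ h1 h3) (hR _ _ _ h2 h4)
  | func h1 h2 => cases h' with | func h3 h4 => exact .func (hR _ _ _ h1 h3) (hR _ _ _ h2 h4)

theorem IsAtom.atomRel_refl {R : Pre C → Pre C → Prop} (hR : ∀ A, R A A) {A : Pre C}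
    (h : IsAtom A) : AtomRel R A A := by
  cases h with
  | var k n => exact .var k n
  | const c => exact .const c
  | comp => exact .comp (hR _) (hR _)
  | func => exact .func (hR _) (hR _)

theorem AtomRel.isAtom {R : Pre C → Pre C → Prop} {A B : Pre C} (h : AtomRel R A B) :
    IsAtom A ∧ IsAtom B := by
  cases h <;> constructor <;> constructor

theorem AtomRel.headMatch {R : Pre C → Pre C → Prop} {A B : Pre C} (h : AtomRel R A B) :
    HeadMatch R A B := by
  simp [HeadMatch, h.isAtom.1.heads_eq, h.isAtom.2.heads_eq, h]

theorem HeadMatch.imp {R R' : Pre C → Pre C → Prop} {A B : Pre C} (h : HeadMatch R A B)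
    (hR : ∀ A B, R A B → R' A B) : HeadMatch R' A B :=
  ⟨fun S hS => (h.1 S hS).imp fun _ hT => ⟨hT.1, hT.2.imp hR⟩,
    fun T hT => (h.2 T hT).imp fun _ hS => ⟨hS.1, hS.2.imp hR⟩⟩

/-! ### Finite approximations of the equality of infinite unfoldings -/

/-- The two expressions agree up to depth `n`, modulo associativity, commutativity and
idempotence of unions. -/
def Approx : ℕ → Pre C → Pre C → Prop
  | 0 => fun _ _ => True
  | n + 1 => HeadMatch (Approx n)

theorem Approx.refl (n : ℕ) : ∀ A : Pre C, Approx n A A := by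
  induction n with
  | zero => exact fun _ => trivial
  | succ n ih =>
    exact fun A => ⟨fun S hS => ⟨S, hS, (isAtom_of_mem_heads hS).atomRel_refl ih⟩,
      fun S hS => ⟨S, hS, (isAtom_of_mem_heads hS).atomRel_refl ih⟩⟩

theorem Approx.symm {n : ℕ} : ∀ {A B : Pre C}, Approx n A B → Approx n B A := by
  induction n with
  | zero => exact fun _ => trivial
  | succ n ih =>
    exact fun h => ⟨fun S hS => (h.2 S hS).imp fun _ hT => ⟨hT.1, hT.2.swap fun _ _ => ih⟩,
      fun S hS => (h.1 S hS).imp fun _ hT => ⟨hT.1, hT.2.swap fun _ _ => ih⟩⟩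

theorem Approx.trans {n : ℕ} : ∀ {A B D : Pre C}, Approx n A B → Approx n B D → Approx n A D := by
  induction n with
  | zero => exact fun _ _ => trivial
  | succ n ih =>
    intro A B D h h'
    constructor
    · intro S hS
      obtain ⟨T, hT, hST⟩ := h.1 S hS
      obtain ⟨U, hU, hTU⟩ := h'.1 T hT
      exact ⟨U, hU, AtomRel.trans (R := Approx n) (fun _ _ _ => ih) hST hTU⟩
    · intro U hU
      obtain ⟨T, hT, hTU⟩ := h'.2 U hU
      obtain ⟨S, hS, hST⟩ := h.2 T hT
      exact ⟨S, hS, AtomRel.trans (R := Approx n) (fun _ _ _ => ih) hST hTU⟩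

theorem Approx.of_succ {n : ℕ} : ∀ {A B : Pre C}, Approx (n + 1) A B → Approx n A B := by
  induction n with
  | zero => exact fun _ => trivial
  | succ n ih => exact fun h => HeadMatch.imp h fun _ _ => ih

theorem Approx.of_le {m n : ℕ} (hmn : m ≤ n) {A B : Pre C} (h : Approx n A B) : Approx m A B := by
  induction hmn with
  | refl => exact h
  | step _ ih => exact ih h.of_succ

/-- Approximations see an expression only through its heads, so the laws of `⊕` and unfolding reduce
to equalities of sets. -/
theorem Approx.of_heads_eq {A B : Pre C} (h : heads A = heads B) (n : ℕ) : Approx n A B := by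
  cases n with
  | zero => trivial
  | succ n =>
    have := Approx.refl (n + 1) A
    rwa [Approx, HeadMatch, h] at this ⊢

theorem Approx.mu_unfold (n : ℕ) (k : Kind) (A : Pre C) : Approx n (mu k A) (unfold k A) :=
  .of_heads_eq (heads_unfold k A).symm n

theorem Approx.union {n : ℕ} {A A' B B' : Pre C} (hA : Approx n A A') (hB : Approx n B B') :
    Approx n (union A B) (union A' B') := by
  cases n with
  | zero => trivial
  | succ n =>
    constructor
    · rintro S (hS | hS)
      · exact (hA.1 S hS).imp fun _ h => ⟨.inl h.1, h.2⟩
      · exact (hB.1 S hS).imp fun _ h => ⟨.inr h.1, h.2⟩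
    · rintro S (hS | hS)
      · exact (hA.2 S hS).imp fun _ h => ⟨.inl h.1, h.2⟩
      · exact (hB.2 S hS).imp fun _ h => ⟨.inr h.1, h.2⟩

theorem AtomRel.heads_subst {n : ℕ} {σ τ : Kind → ℕ → Pre C} {S S' : Pre C}
    (h : AtomRel (Approx n) S S')
    (hsub : ∀ A B, Approx n A B → Approx n (subst σ A) (subst τ B))
    (hvar : ∀ l m, S = Pre.var l m → Approx (n + 1) (σ l m) (τ l m)) :
    HeadMatch (Approx n) (subst σ S) (subst τ S') := by
  cases h with
  | var k m => exact hvar k m rfl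
  | const c => exact (AtomRel.const c).headMatch
  | comp h1 h2 => exact (AtomRel.comp (hsub _ _ h1) (hsub _ _ h2)).headMatch
  | func h1 h2 => exact (AtomRel.func (hsub _ _ h1) (hsub _ _ h2)).headMatch

/-- Substitution respects approximate equality; it gains one level at guarded variables. -/
theorem Approx.subst_succ {n : ℕ} {σ τ : Kind → ℕ → Pre C} {A B : Pre C}
    (hAB : Approx (n + 1) A B)
    (hsub : ∀ A B, Approx n A B → Approx n (subst σ A) (subst τ B))
    (hvar : ∀ l m, ¬ Guarded l m A → Approx (n + 1) (σ l m) (τ l m)) :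
    Approx (n + 1) (subst σ A) (subst τ B) := by
  have key : ∀ S ∈ heads A, ∀ S', AtomRel (Approx n) S S' →
      HeadMatch (Approx n) (subst σ S) (subst τ S') := by
    intro S hS S' h
    refine h.heads_subst hsub fun l m hlm => hvar l m ?_
    rw [guarded_iff, not_not, ← hlm]
    exact hS
  constructor
  · intro T hT
    obtain ⟨S, hS, hT⟩ := (mem_heads_subst A σ).1 hT
    obtain ⟨S', hS', hSS⟩ := hAB.1 S hS
    obtain ⟨T', hT', h⟩ := (key S hS S' hSS).1 T hT
    exact ⟨T', (mem_heads_subst B τ).2 ⟨S', hS', hT'⟩, h⟩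
  · intro T hT
    obtain ⟨S', hS', hT⟩ := (mem_heads_subst B τ).1 hT
    obtain ⟨S, hS, hSS⟩ := hAB.2 S' hS'
    obtain ⟨T', hT', h⟩ := (key S hS S' hSS).2 T hT
    exact ⟨T', (mem_heads_subst A σ).2 ⟨S, hS, hT'⟩, h⟩

theorem Approx.subst {n : ℕ} : ∀ {σ τ : Kind → ℕ → Pre C} {A B : Pre C},
    (∀ l m, Approx n (σ l m) (τ l m)) → Approx n A B → Approx n (subst σ A) (subst τ B) := by
  induction n with
  | zero => exact fun _ _ => trivial
  | succ n ih =>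
    intro σ τ A B h hAB
    exact hAB.subst_succ (fun A B => ih fun l m => (h l m).of_succ) fun l m _ => h l m

/-- The guarded variable occurs only below a constructor, which already accounts for one level, so
its values need to agree only to depth `n`. -/
theorem Approx.inst_succ {n : ℕ} {k : Kind} {S T A B : Pre C} (hA : Guarded k 0 A)
    (hST : Approx n S T) (hAB : Approx (n + 1) A B) :
    Approx (n + 1) (inst k S A) (inst k T B) := by
  rw [inst_eq, inst_eq]
  refine hAB.subst_succ (fun A B => Approx.subst fun l m => ?_) fun l m => ?_
  · refine kind_index_cases k (P := fun l m => Approx n (consSub k S var l m)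
      (consSub k T var l m)) (by simpa using hST) ?_ l m
    intro l m
    simpa using Approx.refl n _
  · refine kind_index_cases k (P := fun l m => ¬ Guarded l m A →
      Approx (n + 1) (consSub k S var l m) (consSub k T var l m)) (fun h => (h hA).elim) ?_ l m
    intro l m _
    simpa using Approx.refl (n + 1) _

/-- Type equivalence is sound for the equality of infinite unfoldings. -/
theorem Equiv.approx {A B : Pre C} (h : Equiv A B) : ∀ n, Approx n A B := by
  induction h with
  | refl => exact fun n => .refl n _
  | trans _ _ ih ih' => exact fun n => (ih n).trans (ih' n)
  | symm _ ih => exact fun n => (ih n).symm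
  | comp _ _ _ _ ih ih' =>
    rintro (_ | n)
    · trivial
    · exact (AtomRel.comp (ih n) (ih' n)).headMatch
  | func _ _ ih ih' =>
    rintro (_ | n)
    · trivial
    · exact (AtomRel.func (ih n) (ih' n)).headMatch
  | union_idem => exact .of_heads_eq (Set.union_self _)
  | union_comm => exact .of_heads_eq (Set.union_comm _ _)
  | union_assoc => exact .of_heads_eq (Set.union_assoc _ _ _).symm
  | union _ _ ih ih' => exact fun n => (ih n).union (ih' n)
  | @recursion k A B hA hB _ ih =>
    intro n
    induction n with
    | zero => trivial
    | succ n ihn =>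
      -- Unfold both sides: the `μ`s agree to depth `n` by induction, the bodies to depth `n + 1`.
      exact (Approx.mu_unfold _ k A).trans
        ((Approx.inst_succ hA.2.1 ihn (ih (n + 1))).trans (Approx.mu_unfold _ k B).symm)
  | fold => exact fun n => .mu_unfold n _ _
  | @contr k A B _ hB _ ih =>
    intro n
    induction n with
    | zero => trivial
    | succ n ihn =>
      -- Uniqueness of solutions of guarded equations: `A` and `mu k B` both solve the equation
      -- given by `B`, so each level of agreement yields the next.
      exact (ih (n + 1)).trans
        ((Approx.inst_succ hB.2.1 ihn (Approx.refl _ B)).trans (Approx.mu_unfold _ k B).symm)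

/-! ### Passage to the limit of the approximations -/

theorem AtomRel.forall_approx {S T : Pre C} (h : ∀ n, AtomRel (Approx n) S T) :
    AtomRel (fun A B => ∀ n, Approx n A B) S T := by
  -- Level `0` already fixes the common root; only the arguments depend on the level.
  cases h 0 with
  | var k n => exact .var k n
  | const c => exact .const c
  | comp =>
    refine .comp (fun n => ?_) (fun n => ?_) <;> cases h n <;> assumption
  | func =>
    refine .func (fun n => ?_) (fun n => ?_) <;> cases h n <;> assumption

/-- If every candidate failed at some level, a level above these finitely many failures would have
no witness. This yields one matching head that works at all depths. -/
theorem exists_forall_of_forall_exists {α : Type*} {s : Set α} (hs : s.Finite)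
    {P : ℕ → α → Prop} (hP : ∀ m n, m ≤ n → ∀ a, P n a → P m a) (h : ∀ n, ∃ a ∈ s, P n a) :
    ∃ a ∈ s, ∀ n, P n a := by
  by_contra! hcon
  choose! f hf using hcon
  obtain ⟨N, hN⟩ := (hs.image f).bddAbove
  obtain ⟨a, ha, hPa⟩ := h N
  exact hf a ha (hP _ _ (hN ⟨a, ha, rfl⟩) a hPa)

/-- Equality at all depths is a fixed point of `HeadMatch`. -/
theorem headMatch_of_forall_approx {A B : Pre C} (h : ∀ n, Approx n A B) :
    HeadMatch (fun A B => ∀ n, Approx n A B) A B := by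
  constructor
  · intro S hS
    obtain ⟨T, hT, hST⟩ := exists_forall_of_forall_exists (finite_heads B)
      (P := fun n T => AtomRel (Approx n) S T) (fun m n hmn _ h => h.imp fun _ _ => .of_le hmn)
      fun n => (h (n + 1)).1 S hS
    exact ⟨T, hT, .forall_approx hST⟩
  · intro T hT
    obtain ⟨S, hS, hST⟩ := exists_forall_of_forall_exists (finite_heads A)
      (P := fun n S => AtomRel (Approx n) S T) (fun m n hmn _ h => h.imp fun _ _ => .of_le hmn)
      fun n => (h (n + 1)).2 T hT
    exact ⟨S, hS, .forall_approx hST⟩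

/-! ### Coinductive equality and matching of heads -/

theorem heads_eq_summands {A : Pre C} (h : ∀ S ∈ summands A, ¬ IsRec S) :
    heads A = {S | S ∈ summands A} := by
  induction A with
  | union A B ihA ihB =>
    rw [heads_union, ihA fun S hS => h S (List.mem_append_left _ hS),
      ihB fun S hS => h S (List.mem_append_right _ hS)]
    ext S
    simp [summands]
  | mu k A => exact (h (mu k A) (by simp [summands]) ⟨k, A, rfl⟩).elim
  | _ => ext S; simp [summands]

theorem summands_ne_nil (A : Pre C) : summands A ≠ [] := by
  induction A <;> simp_all [summands]

theorem summands_fill_mu (K : UCtx C) (k : Kind) (A : Pre C) :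
    mu k A ∈ summands (K.fill (mu k A)) := by
  induction K with
  | hole => simp [UCtx.fill, summands]
  | left K B ih => exact List.mem_append_left _ ih
  | right B K ih => exact List.mem_append_right _ ih

theorem exists_fill_mu {A : Pre C} (h : ∃ S ∈ summands A, IsRec S) :
    ∃ (K : UCtx C) (k : Kind) (B : Pre C), K.Leftmost ∧ A = K.fill (mu k B) := by
  induction A with
  | union A B ihA ihB =>
    by_cases hA : ∃ S ∈ summands A, IsRec S
    · obtain ⟨K, k, D, hK, rfl⟩ := ihA hA
      exact ⟨.left K B, k, D, hK, rfl⟩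
    · push Not at hA
      obtain ⟨S, hS, hrec⟩ := h
      have hSB : S ∈ summands B := (List.mem_append.1 hS).resolve_left fun h => hA S h hrec
      obtain ⟨K, k, D, hK, rfl⟩ := ihB ⟨S, hSB, hrec⟩
      exact ⟨.right A K, k, D, ⟨hA, hK⟩, rfl⟩
  | mu k A => exact ⟨.hole, k, A, trivial, rfl⟩
  | _ =>
    obtain ⟨S, hS, k, D, rfl⟩ := h
    simp [summands] at hS

theorem heads_fill_congr (K : UCtx C) {A B : Pre C} (h : heads A = heads B) :
    heads (K.fill A) = heads (K.fill B) := by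
  induction K <;> simp_all [UCtx.fill]

theorem IsType.fill_unfold {K : UCtx C} {k : Kind} {A : Pre C} (h : IsType (K.fill (mu k A))) :
    IsType (K.fill (unfold k A)) := by
  induction K with
  | hole => exact h.unfold
  | left K B ih => exact isType_union.2 ⟨ih (isType_union.1 h).1, (isType_union.1 h).2⟩
  | right B K ih => exact isType_union.2 ⟨(isType_union.1 h).1, ih (isType_union.1 h).2⟩

theorem IsType.height_fill_unfold {K : UCtx C} {k : Kind} {A : Pre C}
    (h : IsType (K.fill (mu k A))) :
    height (K.fill (unfold k A)) < height (K.fill (mu k A)) := by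
  induction K with
  | hole =>
    rw [UCtx.fill, UCtx.fill, height_unfold h.2.1]
    exact Nat.lt_succ_self _
  | left K B ih =>
    have := ih (isType_union.1 h).1
    simp only [UCtx.fill, height]
    omega
  | right B K ih =>
    have := ih (isType_union.1 h).2
    simp only [UCtx.fill, height]
    omega

theorem coEq_iff {A B : Pre C} :
    CoEq A B ↔ IsType A ∧ IsType B ∧ Rule CoEq A B := by
  have h : genFun (CoEq (C := C)) = CoEq := OrderHom.map_gfp genFun
  conv_lhs => rw [← h]
  rfl

/-- Expressions equal at all depths are coinductively equal. -/
theorem coEq_of_forall_approx {A B : Pre C} (hA : IsType A) (hB : IsType B)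
    (h : ∀ n, Approx n A B) : CoEq A B := by
  let R : Pre C → Pre C → Prop := fun A B => IsType A ∧ IsType B ∧ ∀ n, Approx n A B
  suffices hR : R ≤ genFun R from OrderHom.le_gfp genFun hR A B ⟨hA, hB, h⟩
  rintro A B ⟨hA, hB, h⟩
  refine ⟨hA, hB, ?_⟩
  -- The cases follow the priorities of the rules: unfold on the left while possible, then on the
  -- right, and compare summands only when no `μ` is left among them.
  by_cases hrA : ∃ S ∈ summands A, IsRec S
  · obtain ⟨K, k, D, hK, rfl⟩ := exists_fill_mu hrA
    exact .rec_l hK ⟨hA.fill_unfold, hB, fun n =>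
      (Approx.of_heads_eq (heads_fill_congr K (heads_unfold k D)) n).trans (h n)⟩
  push Not at hrA
  by_cases hrB : ∃ S ∈ summands B, IsRec S
  · obtain ⟨K, k, D, hK, rfl⟩ := exists_fill_mu hrB
    refine .rec_r hK ?_ ⟨hA, hB.fill_unfold, fun n =>
      (h n).trans (Approx.of_heads_eq (heads_fill_congr K (heads_unfold k D)).symm n)⟩
    rintro K' l D' - rfl
    exact hrA _ (summands_fill_mu K' l D') ⟨l, D', rfl⟩
  push Not at hrB
  have hm := headMatch_of_forall_approx h
  have hR : ∀ S ∈ heads A, ∀ T ∈ heads B, AtomRel (fun A B => ∀ n, Approx n A B) S T →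
      R S T := by
    intro S hS T hT hST
    refine ⟨hA.of_mem_heads hS, hB.of_mem_heads hT, ?_⟩
    rintro (_ | n)
    · trivial
    · exact (hST.imp fun _ _ h => h n).headMatch
  have hsA := heads_eq_summands hrA
  have hsB := heads_eq_summands hrB
  by_cases hlen : 2 < (summands A).length + (summands B).length
  · have hf : ∀ i : Fin (summands A).length, ∃ j : Fin (summands B).length,
        R ((summands A).get i) ((summands B).get j) := by
      intro i
      have hi : (summands A).get i ∈ heads A := hsA ▸ List.get_mem _ _
      obtain ⟨T, hT, hST⟩ := hm.1 _ hi
      obtain ⟨j, rfl⟩ := List.get_of_mem (hsB ▸ hT : T ∈ {S | S ∈ summands B})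
      exact ⟨j, hR _ hi _ hT hST⟩
    have hg : ∀ j : Fin (summands B).length, ∃ i : Fin (summands A).length,
        R ((summands A).get i) ((summands B).get j) := by
      intro j
      have hj : (summands B).get j ∈ heads B := hsB ▸ List.get_mem _ _
      obtain ⟨S, hS, hST⟩ := hm.2 _ hj
      obtain ⟨i, rfl⟩ := List.get_of_mem (hsA ▸ hS : S ∈ {S | S ∈ summands A})
      exact ⟨i, hR _ hS _ hj hST⟩
    choose f hf using hf
    choose g hg using hg
    exact .union f g hrA hrB hlen hf hg
  -- With one summand on each side the union rule is unavailable; both sides are atoms and a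
  -- structural rule applies.
  · have hlen' : ∀ A : Pre C, 0 < (summands A).length :=
      fun A => List.length_pos_iff.2 (summands_ne_nil A)
    have hatom : ∀ A : Pre C, (∀ S ∈ summands A, ¬ IsRec S) → (summands A).length = 1 →
        IsAtom A := by
      intro A hr hl
      cases A with
      | union A B =>
        have := hlen' A
        have := hlen' B
        simp only [summands, List.length_append] at hl
        omega
      | mu k A => exact (hr (mu k A) (by simp [summands]) ⟨k, A, rfl⟩).elim
      | _ => constructor
    have h1 := hlen' A
    have h2 := hlen' B
    have hA1 := hatom A hrA (by omega)
    have hB1 := hatom B hrB (by omega)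
    obtain ⟨T, hT, hST⟩ := hm.1 A (by rw [hA1.heads_eq]; rfl)
    rw [hB1.heads_eq, Set.mem_singleton_iff] at hT
    subst hT
    cases hST with
    | var k n => exact .refl_var k n
    | const c => exact .refl_const c
    | comp h3 h4 =>
      exact .comp ⟨hA.comp.1.isType, hB.comp.1.isType, h3⟩ ⟨hA.comp.2, hB.comp.2, h4⟩
    | func h3 h4 =>
      exact .func ⟨hA.func.1, hB.func.1, h3⟩ ⟨hA.func.2, hB.func.2, h4⟩

theorem IsAtom.not_isRec {A : Pre C} (h : IsAtom A) : ∀ S ∈ summands A, ¬ IsRec S := by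
  rintro S hS ⟨k, D, rfl⟩
  cases h <;> simp [summands] at hS

theorem IsAtom.length_summands {A : Pre C} (h : IsAtom A) : (summands A).length = 1 := by
  cases h <;> rfl

theorem Rule.atomRel {R : Pre C → Pre C → Prop} {A B : Pre C} (h : Rule R A B) (hA : IsAtom A)
    (hB : IsAtom B) : AtomRel R A B := by
  cases h with
  | refl_var k n => exact .var k n
  | refl_const c => exact .const c
  | comp h1 h2 => exact .comp h1 h2
  | func h1 h2 => exact .func h1 h2
  | @rec_l K k D _ => exact (hA.not_isRec _ (summands_fill_mu K k D) ⟨k, D, rfl⟩).elim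
  | @rec_r K k _ D => exact (hB.not_isRec _ (summands_fill_mu K k D) ⟨k, D, rfl⟩).elim
  | union f g _ _ h => rw [hA.length_summands, hB.length_summands] at h; omega

/-- The two unfolding rules preserve heads and lower the total height, so after finitely many of
them a structural or union rule must appear. -/
theorem CoEq.headMatch {A B : Pre C} (h : CoEq A B) : HeadMatch CoEq A B := by
  induction hn : height A + height B using Nat.strong_induction_on generalizing A B with
  | _ n ih =>
    subst hn
    obtain ⟨hA, hB, hr⟩ := coEq_iff.1 h
    cases hr with
    | refl_var k n => exact (AtomRel.var k n).headMatch
    | refl_const c => exact (AtomRel.const c).headMatch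
    | comp h1 h2 => exact (AtomRel.comp h1 h2).headMatch
    | func h1 h2 => exact (AtomRel.func h1 h2).headMatch
    | @rec_l K k D _ _ h' =>
      have := ih _ (Nat.add_lt_add_right hA.height_fill_unfold _) h' rfl
      rwa [HeadMatch, heads_fill_congr K (heads_unfold k D)] at this
    | @rec_r K k _ D _ _ h' =>
      have := ih _ (Nat.add_lt_add_left hB.height_fill_unfold _) h' rfl
      rwa [HeadMatch, heads_fill_congr K (heads_unfold k D)] at this
    | union f g hrA hrB _ hf hg =>
      have hsA := heads_eq_summands hrA
      have hsB := heads_eq_summands hrB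
      -- The premises of the union rule relate atoms, and `Rule.atomRel` shows that only structural
      -- rules derive these.
      have key : ∀ S ∈ heads A, ∀ T ∈ heads B, CoEq S T → AtomRel CoEq S T :=
        fun S hS T hT h => (coEq_iff.1 h).2.2.atomRel (isAtom_of_mem_heads hS)
          (isAtom_of_mem_heads hT)
      constructor
      · intro S hS
        obtain ⟨i, rfl⟩ := List.get_of_mem (hsA ▸ hS : S ∈ {S | S ∈ summands A})
        have hT : (summands B).get (f i) ∈ heads B := hsB ▸ List.get_mem _ _
        exact ⟨_, hT, key _ hS _ hT (hf i)⟩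
      · intro T hT
        obtain ⟨j, rfl⟩ := List.get_of_mem (hsB ▸ hT : T ∈ {S | S ∈ summands B})
        have hS : (summands A).get (g j) ∈ heads A := hsA ▸ List.get_mem _ _
        exact ⟨_, hS, key _ hS _ hT (hg j)⟩

/-! ### The semilattice of types modulo equivalence -/

theorem Equiv.isType {A B : Pre C} (h : Equiv A B) : IsType A ∧ IsType B := by
  induction h with
  | refl h => exact ⟨h, h⟩
  | trans _ _ ih ih' => exact ⟨ih.1, ih'.2⟩
  | symm _ ih => exact ⟨ih.2, ih.1⟩
  | comp hD hD' _ _ _ ih =>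
    exact ⟨⟨.ofData (.comp hD.1 ih.1.1), hD.2, ih.1.2⟩, .ofData (.comp hD'.1 ih.2.1), hD'.2, ih.2.2⟩
  | func _ _ ih ih' =>
    exact ⟨⟨.func ih.1.1 ih'.1.1, ih.1.2, ih'.1.2⟩, .func ih.2.1 ih'.2.1, ih.2.2, ih'.2.2⟩
  | union_idem h => exact ⟨isType_union.2 ⟨h, h⟩, h⟩
  | union_comm h h' => exact ⟨isType_union.2 ⟨h, h'⟩, isType_union.2 ⟨h', h⟩⟩
  | union_assoc h h' h'' =>
    exact ⟨isType_union.2 ⟨h, isType_union.2 ⟨h', h''⟩⟩, isType_union.2 ⟨isType_union.2 ⟨h, h'⟩, h''⟩⟩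
  | union _ _ ih ih' => exact ⟨isType_union.2 ⟨ih.1, ih'.1⟩, isType_union.2 ⟨ih.2, ih'.2⟩⟩
  | recursion h h' => exact ⟨h.isType, h'.isType⟩
  | fold h => exact ⟨h.isType, h.unfold.isType⟩
  | contr h h' => exact ⟨h.isType, h'.isType⟩

/-- The order of the semilattice of types with unions modulo equivalence. -/
def Below (A B : Pre C) : Prop := Equiv (union A B) B

theorem Below.isType {A B : Pre C} (h : Below A B) : IsType A ∧ IsType B :=
  isType_union.1 (Equiv.isType h).1

theorem Equiv.isBelow {A B : Pre C} (h : Equiv A B) : Below A B :=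
  (Equiv.union h (.refl h.isType.2)).trans (.union_idem h.isType.2)

theorem Below.trans {A B D : Pre C} (h : Below A B) (h' : Below B D) : Below A D := by
  have hA := h.isType.1
  have hB := h.isType.2
  have hD := h'.isType.2
  exact (Equiv.union (.refl hA) (.symm h')).trans ((Equiv.union_assoc hA hB hD).trans
    ((Equiv.union h (.refl hD)).trans h'))

theorem Below.antisymm {A B : Pre C} (h : Below A B) (h' : Below B A) : Equiv A B :=
  (Equiv.symm h').trans ((Equiv.union_comm h.isType.2 h.isType.1).trans h)

theorem Below.union {A B D : Pre C} (h : Below A D) (h' : Below B D) : Below (union A B) D :=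
  (Equiv.union_assoc h.isType.1 h'.isType.1 h.isType.2).symm.trans
    ((Equiv.union (.refl h.isType.1) h').trans h)

theorem below_union_left {A B : Pre C} (hA : IsType A) (hB : IsType B) : Below A (union A B) :=
  (Equiv.union_assoc hA hA hB).trans (Equiv.union (.union_idem hA) (.refl hB))

theorem below_union_right {A B : Pre C} (hA : IsType A) (hB : IsType B) : Below B (union A B) :=
  (below_union_left hB hA).trans (Equiv.union_comm hB hA).isBelow

/-- Together with `IsType.below_of_heads`, this makes every type the join of its heads modulo
equivalence. -/
theorem IsType.below_of_mem_heads {A S : Pre C} (hA : IsType A) (hS : S ∈ heads A) :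
    Below S A := by
  refine unfold_induction (P := fun A => IsType A → ∀ S, S ∈ heads A → Below S A)
    ?_ ?_ ?_ hA hA S hS
  · intro A hat hA S hS
    rw [hat.heads_eq, Set.mem_singleton_iff] at hS
    subst hS
    exact (Equiv.refl hA).isBelow
  · intro A B ihA ihB h S hS
    obtain ⟨hA, hB⟩ := isType_union.1 h
    rcases hS with hS | hS
    · exact (ihA hA S hS).trans (below_union_left hA hB)
    · exact (ihB hB S hS).trans (below_union_right hA hB)
  · intro k A h ih _ S hS
    rw [← heads_unfold] at hS
    exact (ih h.unfold S hS).trans (Equiv.fold h.mu_self).symm.isBelow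

theorem IsType.below_of_heads {A B : Pre C} (hA : IsType A) (h : ∀ S ∈ heads A, Below S B) :
    Below A B := by
  revert h
  refine unfold_induction (P := fun A => (∀ S ∈ heads A, Below S B) → Below A B)
    ?_ ?_ ?_ hA
  · intro A hat h
    exact h A (by rw [hat.heads_eq]; rfl)
  · intro A D ihA ihD h
    exact (ihA fun S hS => h S (.inl hS)).union (ihD fun S hS => h S (.inr hS))
  · intro k A hA ih h
    rw [← heads_unfold] at h
    exact (Equiv.fold hA.mu_self).isBelow.trans (ih h)

/-! ### Subexpressions up to unfolding -/

/-- A finite set of expressions that contains the given one and is closed under taking immediate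
subexpressions and unfolding. -/
def closure : Pre C → Set (Pre C)
  | var k n => {var k n}
  | const c => {const c}
  | comp D A => insert (comp D A) (closure D ∪ closure A)
  | func A B => insert (func A B) (closure A ∪ closure B)
  | union A B => insert (union A B) (closure A ∪ closure B)
  -- Members are taken from the closure of the open body and closed by putting the `μ` back, so
  -- finiteness follows by structural recursion.
  | mu k A => insert (mu k A) (inst k (mu k A) '' closure A)

theorem finite_closure (A : Pre C) : (closure A).Finite := by
  induction A with
  | var k n => exact Set.finite_singleton _
  | const c => exact Set.finite_singleton _
  | mu k A ih => exact (ih.image _).insert _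
  | _ => rename_i ih ih'; exact (ih.union ih').insert _

theorem mem_closure_self (A : Pre C) : A ∈ closure A := by
  cases A <;> simp [closure]

/-- The set is closed under taking immediate subexpressions and unfolding. -/
structure IsClosed (U : Set (Pre C)) : Prop where
  comp {D A : Pre C} : comp D A ∈ U → D ∈ U ∧ A ∈ U
  func {A B : Pre C} : func A B ∈ U → A ∈ U ∧ B ∈ U
  union {A B : Pre C} : union A B ∈ U → A ∈ U ∧ B ∈ U
  mu {k : Kind} {A : Pre C} : mu k A ∈ U → unfold k A ∈ U

theorem IsClosed.sup {U V : Set (Pre C)} (hU : IsClosed U) (hV : IsClosed V) :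
    IsClosed (U ∪ V) where
  comp h := h.elim (fun h => ⟨.inl (hU.comp h).1, .inl (hU.comp h).2⟩)
    fun h => ⟨.inr (hV.comp h).1, .inr (hV.comp h).2⟩
  func h := h.elim (fun h => ⟨.inl (hU.func h).1, .inl (hU.func h).2⟩)
    fun h => ⟨.inr (hV.func h).1, .inr (hV.func h).2⟩
  union h := h.elim (fun h => ⟨.inl (hU.union h).1, .inl (hU.union h).2⟩)
    fun h => ⟨.inr (hV.union h).1, .inr (hV.union h).2⟩
  mu h := h.elim (fun h => .inl (hU.mu h)) fun h => .inr (hV.mu h)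

theorem IsClosed.insert {U : Set (Pre C)} (hU : IsClosed U) {E : Pre C}
    (comp' : ∀ D A, E = Pre.comp D A → D ∈ U ∧ A ∈ U)
    (func' : ∀ A B, E = Pre.func A B → A ∈ U ∧ B ∈ U)
    (union' : ∀ A B, E = Pre.union A B → A ∈ U ∧ B ∈ U)
    (mu' : ∀ k A, E = Pre.mu k A → Pre.unfold k A ∈ insert E U) : IsClosed (insert E U) where
  comp h := (h.elim (fun h => comp' _ _ h.symm) hU.comp).imp .inr .inr
  func h := (h.elim (fun h => func' _ _ h.symm) hU.func).imp .inr .inr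
  union h := (h.elim (fun h => union' _ _ h.symm) hU.union).imp .inr .inr
  mu h := h.elim (fun h => mu' _ _ h.symm) fun h => .inr (hU.mu h)

theorem inst_var_eq (k l : Kind) (n : ℕ) (M : Pre C) :
    (var l n : Pre C) = var k 0 ∧ inst k M (var l n) = M ∨
      ∃ m, inst k M (var l n) = var l m := by
  refine kind_index_cases k (P := fun l n => (var l n : Pre C) = var k 0 ∧
    inst k M (var l n) = M ∨ ∃ m, inst k M (var l n) = var l m) (.inl ⟨rfl, ?_⟩) ?_ l n
  · simp [inst_eq, subst]
  · exact fun l n => .inr ⟨n, by simp [inst_eq, subst]⟩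

/-- For a `μ`, subexpressions of an instance are instances of subexpressions, and unfolding commutes
with substitution. The one exception is the bound variable, whose instance is the `μ` itself; its
unfolding is the instance of the whole body. -/
theorem isClosed_closure (A : Pre C) : IsClosed (closure A) := by
  induction A with
  | var k n => constructor <;> simp [closure]
  | const c => constructor <;> simp [closure]
  | comp D A ihD ihA =>
    refine (ihD.sup ihA).insert ?_ (by simp) (by simp) (by simp)
    rintro _ _ ⟨⟩
    exact ⟨.inl (mem_closure_self _), .inr (mem_closure_self _)⟩
  | func A B ihA ihB =>
    refine (ihA.sup ihB).insert (by simp) ?_ (by simp) (by simp)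
    rintro _ _ ⟨⟩
    exact ⟨.inl (mem_closure_self _), .inr (mem_closure_self _)⟩
  | union A B ihA ihB =>
    refine (ihA.sup ihB).insert (by simp) (by simp) ?_ (by simp)
    rintro _ _ ⟨⟩
    exact ⟨.inl (mem_closure_self _), .inr (mem_closure_self _)⟩
  | mu k A ih =>
    have hmu : unfold k A ∈ closure (mu k A) := .inr ⟨A, mem_closure_self A, rfl⟩
    constructor
    · rintro D B (h | ⟨S, hS, h⟩)
      · cases h
      · cases S with
        | var l n =>
          rcases inst_var_eq k l n (mu k A) with ⟨-, h'⟩ | ⟨m, h'⟩ <;> rw [h'] at h <;> cases h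
        | comp S T =>
          rw [inst_eq] at h
          cases h
          exact ⟨.inr ⟨S, (ih.comp hS).1, inst_eq _ _ _⟩, .inr ⟨T, (ih.comp hS).2, inst_eq _ _ _⟩⟩
        | _ => rw [inst_eq] at h; cases h
    · rintro D B (h | ⟨S, hS, h⟩)
      · cases h
      · cases S with
        | var l n =>
          rcases inst_var_eq k l n (mu k A) with ⟨-, h'⟩ | ⟨m, h'⟩ <;> rw [h'] at h <;> cases h
        | func S T =>
          rw [inst_eq] at h
          cases h
          exact ⟨.inr ⟨S, (ih.func hS).1, inst_eq _ _ _⟩, .inr ⟨T, (ih.func hS).2, inst_eq _ _ _⟩⟩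
        | _ => rw [inst_eq] at h; cases h
    · rintro D B (h | ⟨S, hS, h⟩)
      · cases h
      · cases S with
        | var l n =>
          rcases inst_var_eq k l n (mu k A) with ⟨-, h'⟩ | ⟨m, h'⟩ <;> rw [h'] at h <;> cases h
        | union S T =>
          rw [inst_eq] at h
          cases h
          exact ⟨.inr ⟨S, (ih.union hS).1, inst_eq _ _ _⟩,
            .inr ⟨T, (ih.union hS).2, inst_eq _ _ _⟩⟩
        | _ => rw [inst_eq] at h; cases h
    · rintro l B (h | ⟨S, hS, h⟩)
      · cases h
        exact hmu
      · cases S with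
        | var l n =>
          rcases inst_var_eq k l n (mu k A) with ⟨-, h'⟩ | ⟨m, h'⟩ <;> rw [h'] at h <;> cases h
          exact hmu
        | mu l S =>
          rw [inst_eq] at h
          cases h
          exact .inr ⟨_, ih.mu hS, by rw [inst_eq, subst_unfold]⟩
        | _ => rw [inst_eq] at h; cases h

theorem IsClosed.mem_of_mem_heads {U : Set (Pre C)} (hU : IsClosed U) {j : Kind} {A S : Pre C}
    (hA : IsMu j A) (hAU : A ∈ U) (hS : S ∈ heads A) : S ∈ U := by
  refine unfold_induction (P := fun A => A ∈ U → ∀ S, S ∈ heads A → S ∈ U) ?_ ?_ ?_ hA hAU S hS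
  · intro A hat hAU S hS
    rw [hat.heads_eq, Set.mem_singleton_iff] at hS
    exact hS ▸ hAU
  · intro A B ihA ihB hAU S hS
    exact hS.elim (ihA (hU.union hAU).1 S) (ihB (hU.union hAU).2 S)
  · intro k A _ ih hAU S hS
    rw [← heads_unfold] at hS
    exact ih (hU.mu hAU) S hS

/-! ### Completeness of type equivalence -/

/-- Finitely many pairs of types which are simultaneous instances of guarded expressions have unions
which are simultaneous instances of one guarded expression. -/
theorem exists_guarded_union {k : Kind} {σ τ : Kind → ℕ → Pre C} (hσ : ∀ l n, IsMu l (σ l n))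
    (hτ : ∀ l n, IsMu l (τ l n)) {M : Set (Pre C × Pre C)} (hfin : M.Finite) :
    M.Nonempty → (∀ p ∈ M, ∃ G, IsMu k G ∧ Guarded k 0 G ∧ Equiv (subst σ G) p.1 ∧
      Equiv (subst τ G) p.2) →
    ∃ G, IsMu k G ∧ Guarded k 0 G ∧
      (∀ p ∈ M, Below p.1 (subst σ G) ∧ Below p.2 (subst τ G)) ∧
      (∀ B, (∀ p ∈ M, Below p.1 B) → Below (subst σ G) B) ∧
      ∀ B, (∀ p ∈ M, Below p.2 B) → Below (subst τ G) B := by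
  induction M, hfin using Set.Finite.induction_on with
  | empty => exact fun h => (Set.not_nonempty_empty h).elim
  | @insert p M _ _ ih =>
    intro _ hM
    obtain ⟨G, hG, hg, h1, h2⟩ := hM p (.inl rfl)
    -- There is no empty union, so the induction effectively starts from a single pair.
    rcases M.eq_empty_or_nonempty with rfl | hne
    · refine ⟨G, hG, hg, ?_, fun B hB => h1.isBelow.trans (hB p (.inl rfl)),
        fun B hB => h2.isBelow.trans (hB p (.inl rfl))⟩
      rintro q (rfl | hq)
      · exact ⟨h1.symm.isBelow, h2.symm.isBelow⟩
      · exact hq.elim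
    · obtain ⟨H, hH, hg', hM', h3, h4⟩ := ih hne fun q hq => hM q (.inr hq)
      have hsG := (hG.subst hσ).isType
      have htG := (hG.subst hτ).isType
      have hsH := (hH.subst hσ).isType
      have htH := (hH.subst hτ).isType
      refine ⟨union G H, ⟨.union hG.1 hH.1, hG.2, hH.2⟩, ⟨hg, hg'⟩, ?_, ?_, ?_⟩
      · rintro q (rfl | hq)
        · exact ⟨h1.symm.isBelow.trans (below_union_left hsG hsH),
            h2.symm.isBelow.trans (below_union_left htG htH)⟩
        · exact ⟨(hM' q hq).1.trans (below_union_right hsG hsH),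
            (hM' q hq).2.trans (below_union_right htG htH)⟩
      · exact fun B hB => (h1.isBelow.trans (hB p (.inl rfl))).union
          (h3 B fun q hq => hB q (.inr hq))
      · exact fun B hB => (h2.isBelow.trans (hB p (.inl rfl))).union
          (h4 B fun q hq => hB q (.inr hq))

theorem heads_nonempty {j : Kind} {A : Pre C} (hA : IsMu j A) : (heads A).Nonempty := by
  refine unfold_induction (P := fun A => (heads A).Nonempty) ?_ ?_ ?_ hA
  · intro A hat
    exact ⟨A, by rw [hat.heads_eq]; rfl⟩
  · exact fun A B hA _ => hA.inl
  · intro k A _ h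
    rwa [← heads_unfold]

/-! ### Recorded pairs and the termination measure -/

/-- The variables which are instantiated by the same variable under both substitutions exhaust all
variables. -/
def CommonVars (σ τ : Kind → ℕ → Pre C) : Prop :=
  ∀ l n, ∃ m, σ l m = var l n ∧ τ l m = var l n

/-- The pairs over `U` which are not the two instances of a variable. -/
def freshPairs (U : Set (Pre C)) (σ τ : Kind → ℕ → Pre C) : Set (Kind × Pre C × Pre C) :=
  {p | p.2.1 ∈ U ∧ p.2.2 ∈ U ∧ ∀ n, ¬ (σ p.1 n = p.2.1 ∧ τ p.1 n = p.2.2)}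

theorem finite_freshPairs {U : Set (Pre C)} (hU : U.Finite) (σ τ : Kind → ℕ → Pre C) :
    (freshPairs U σ τ).Finite := by
  have hK : (Set.univ : Set Kind).Finite := by
    refine Set.Finite.subset (Set.toFinite {Kind.data, Kind.type}) ?_
    rintro (_ | _) - <;> simp
  exact (hK.prod (hU.prod hU)).subset fun p hp => ⟨trivial, hp.1, hp.2.1⟩

/-- Old assignments survive with shifted indices, while the new variable removes its own triple.
This bounds the construction of templates. -/
theorem ncard_freshPairs_consSub {U : Set (Pre C)} (hU : U.Finite) {σ τ : Kind → ℕ → Pre C}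
    {k : Kind} {A B : Pre C} (h : (k, A, B) ∈ freshPairs U σ τ) :
    (freshPairs U (consSub k A σ) (consSub k B τ)).ncard < (freshPairs U σ τ).ncard := by
  refine Set.ncard_lt_ncard ⟨?_, fun hsub => ?_⟩ (finite_freshPairs hU σ τ)
  · rintro ⟨l, S, T⟩ ⟨hS, hT, hn⟩
    refine ⟨hS, hT, fun n => ?_⟩
    have := hn (shiftRen k l n)
    simpa using this
  · exact (hsub h).2.2 0 (by simp)

/-- The atomic case of completeness: related atoms are simultaneous instances of a guarded
expression, provided that this holds for their related arguments. -/
theorem exists_guarded_of_atomRel {R : Pre C → Pre C → Prop} {k : Kind} {A B S T : Pre C}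
    {σ τ : Kind → ℕ → Pre C} (hvar : CommonVars σ τ) (h : AtomRel R S T) (hS : IsMu k S)
    (hT : IsMu k T)
    (hsub : ∀ {j : Kind} {S' T' : Pre C}, IsMu j S' → IsMu j T' →
      (∀ U, IsClosed U → S ∈ U → S' ∈ U) → (∀ U, IsClosed U → T ∈ U → T' ∈ U) → R S' T' →
      ∃ G, IsMu j G ∧ Equiv (subst (consSub k A σ) G) S' ∧ Equiv (subst (consSub k B τ) G) T')
    (hA : IsMu k A) (hB : IsMu k B) (hσ : ∀ l n, IsMu l (σ l n)) (hτ : ∀ l n, IsMu l (τ l n)) :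
    ∃ G, IsMu k G ∧ Guarded k 0 G ∧ Equiv (subst (consSub k A σ) G) S ∧
      Equiv (subst (consSub k B τ) G) T := by
  have hσ' := isMu_consSub hA hσ
  have hτ' := isMu_consSub hB hτ
  cases h with
  | var l n =>
    obtain ⟨m, h1, h2⟩ := hvar l n
    -- The shift keeps this free variable distinct from the new bound variable, hence guarded.
    refine ⟨var l (shiftRen k l m), ⟨sorted_var_index hS.1 _, trivial⟩, ?_, ?_, ?_⟩
    · rw [guarded_iff]
      exact fun h => var_shiftRen_ne k l m (Set.mem_singleton_iff.1 h).symm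
    · rw [subst, consSub_shiftRen, h1]
      exact .refl hS.isType
    · rw [subst, consSub_shiftRen, h2]
      exact .refl hT.isType
  | const c => exact ⟨const c, hS, trivial, .refl hS.isType, .refl hT.isType⟩
  | comp h1 h2 =>
    obtain ⟨G, hG, e1, e2⟩ := hsub hS.comp.1 hT.comp.1 (fun U hU h => (hU.comp h).1)
      (fun U hU h => (hU.comp h).1) h1
    obtain ⟨H, hH, e3, e4⟩ := hsub hS.comp.2 hT.comp.2 (fun U hU h => (hU.comp h).2)
      (fun U hU h => (hU.comp h).2) h2
    have hc : Sorted .data (comp G H) := .comp hG.1 hH.1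
    refine ⟨comp G H, ⟨?_, hG.2, hH.2⟩, trivial, .comp (hG.subst hσ') hS.comp.1 e1 e3,
      .comp (hG.subst hτ') hT.comp.1 e2 e4⟩
    cases k with
    | data => exact hc
    | type => exact .ofData hc
  | func h1 h2 =>
    obtain ⟨G, hG, e1, e2⟩ := hsub hS.func.1 hT.func.1 (fun U hU h => (hU.func h).1)
      (fun U hU h => (hU.func h).1) h1
    obtain ⟨H, hH, e3, e4⟩ := hsub hS.func.2 hT.func.2 (fun U hU h => (hU.func h).2)
      (fun U hU h => (hU.func h).2) h2
    obtain rfl := (sorted_func hS.1).1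
    exact ⟨func G H, ⟨.func hG.1 hH.1, hG.2, hH.2⟩, trivial, .func e1 e3, .func e2 e4⟩

/-- Expressions related by a relation that entails matching of heads are, up to type equivalence,
simultaneous instances of one expression. -/
theorem exists_common_template {R : Pre C → Pre C → Prop}
    (hR : ∀ A B, R A B → HeadMatch R A B) {U : Set (Pre C)} (hfin : U.Finite) (hU : IsClosed U)
    (N : ℕ) : ∀ {σ τ : Kind → ℕ → Pre C}, (∀ l n, IsMu l (σ l n)) → (∀ l n, IsMu l (τ l n)) →
      CommonVars σ τ → (freshPairs U σ τ).ncard ≤ N →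
      ∀ {k : Kind} {A B : Pre C}, A ∈ U → B ∈ U → IsMu k A → IsMu k B → R A B →
      ∃ G, IsMu k G ∧ Equiv (subst σ G) A ∧ Equiv (subst τ G) B := by
  induction N using Nat.strong_induction_on with
  | _ N ih =>
  intro σ τ hσ hτ hvar hN k A B hAU hBU hA hB hAB
  -- A pair already recorded closes a loop: its variable is the template.
  by_cases hex : ∃ n, σ k n = A ∧ τ k n = B
  · obtain ⟨n, rfl, rfl⟩ := hex
    exact ⟨var k n, isMu_var k n, .refl hA.isType, .refl hB.isType⟩
  have hlt : (freshPairs U (consSub k A σ) (consSub k B τ)).ncard < N :=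
    (ncard_freshPairs_consSub hfin ⟨hAU, hBU, fun n h => hex ⟨n, h⟩⟩).trans_le hN
  have hσ' := isMu_consSub hA hσ
  have hτ' := isMu_consSub hB hτ
  have hvar' : CommonVars (consSub k A σ) (consSub k B τ) := fun l n =>
    (hvar l n).elim fun m hm => ⟨shiftRen k l m, by simpa using hm⟩
  have hm := hR A B hAB
  -- All matched pairs are kept, not a chosen matching; `hm` ensures that every head of either side
  -- occurs in one.
  let M : Set (Pre C × Pre C) := {p | p.1 ∈ heads A ∧ p.2 ∈ heads B ∧ AtomRel R p.1 p.2}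
  have hMfin : M.Finite := ((finite_heads A).prod (finite_heads B)).subset
    fun p hp => ⟨hp.1, hp.2.1⟩
  have hMne : M.Nonempty := by
    obtain ⟨S, hS⟩ := heads_nonempty hA
    obtain ⟨T, hT, h⟩ := hm.1 S hS
    exact ⟨(S, T), hS, hT, h⟩
  obtain ⟨G, hG, hg, h1, h2, h3⟩ := exists_guarded_union (k := k) hσ' hτ' hMfin hMne (by
    rintro ⟨S, T⟩ ⟨hS, hT, h⟩
    have hSU := hU.mem_of_mem_heads hA hAU hS
    have hTU := hU.mem_of_mem_heads hB hBU hT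
    exact exists_guarded_of_atomRel hvar h (hA.of_mem_heads hS) (hB.of_mem_heads hT)
      (fun hS' hT' hSU' hTU' h' =>
        ih _ hlt hσ' hτ' hvar' le_rfl (hSU' U hU hSU) (hTU' U hU hTU) hS' hT' h') hA hB hσ hτ)
  have eA : Equiv A (subst (consSub k A σ) G) := by
    refine (hA.isType.below_of_heads fun S hS => ?_).antisymm
      (h2 A fun p hp => hA.isType.below_of_mem_heads hp.1)
    obtain ⟨T, hT, h⟩ := hm.1 S hS
    exact (h1 (S, T) ⟨hS, hT, h⟩).1
  have eB : Equiv B (subst (consSub k B τ) G) := by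
    refine (hB.isType.below_of_heads fun T hT => ?_).antisymm
      (h3 B fun p hp => hB.isType.below_of_mem_heads hp.2.1)
    obtain ⟨S, hS, h⟩ := hm.2 T hT
    exact (h1 (S, T) ⟨hS, hT, h⟩).2
  have hmuG : IsMu k (mu k G) := ⟨.mu hG.1, hg, hG.2⟩
  -- `eA` and `eB` present `A` and `B` as fixed points of the two instances of `G`, which is the
  -- premise of (contr).
  refine ⟨mu k G, hmuG, ?_, ?_⟩
  · refine (Equiv.contr hA (hmuG.subst hσ) ?_).symm
    rwa [inst_subst_liftSub]
  · refine (Equiv.contr hB (hmuG.subst hτ) ?_).symm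
    rwa [inst_subst_liftSub]

theorem equiv_of_headMatch {R : Pre C → Pre C → Prop} (hR : ∀ A B, R A B → HeadMatch R A B)
    {A B : Pre C} (hA : IsType A) (hB : IsType B) (h : R A B) : Equiv A B := by
  obtain ⟨G, -, h1, h2⟩ := exists_common_template hR ((finite_closure A).union (finite_closure B))
    ((isClosed_closure A).sup (isClosed_closure B)) _ isMu_var isMu_var
    (fun l n => ⟨n, rfl, rfl⟩) le_rfl (.inl (mem_closure_self A)) (.inr (mem_closure_self B)) hA hB h
  exact h1.symm.trans h2

end Pre

end MuTypes

theorem mainTheorem2 {C : Type*} (A B : MuTypes.Pre C)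
    (hA : MuTypes.Pre.IsType A) (hB : MuTypes.Pre.IsType B) :
    MuTypes.Pre.CoEq A B ↔ MuTypes.Pre.Equiv A B :=
  ⟨MuTypes.Pre.equiv_of_headMatch (fun _ _ h => h.headMatch) hA hB,
    fun h => MuTypes.Pre.coEq_of_forall_approx hA hB h.approx⟩
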